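/- Let $M\subset\mathbf C^{2p}$ be a quadratic submanifold $z_{p+j}=E_j(z',\overline z')$, $1\le j\le p$, where $z'=(z_1,\dots,z_p)$ and each $E_j(z',w')$ is a homogeneous quadratic polynomial in $(z',w')\in\mathbf C^p\times\mathbf C^p$. Put $q(w')=E(0,w')$ and assume $q^{-1}(0)=\{0\}$. A deck transformation of $\pi_1\colon(z',w')\mapsto(z',E(z',w'))$ is a germ at $0$ of a biholomorphic map $\tau$ of $\mathbf C^{2p}$ with $\tau(0)=0$ and $\pi_1\circ\tau=\pi_1$. Assume that $\pi_1$ has exactly $2^p$ deck transformations (condition D). Let $T_1$ be the (linear) deck transformation whose fixed-point set has the smallest dimension, namely $p$; let $\rho_0(z',w')=(\overline{w'},\overline{z'})$ and $T_2=\rho_0T_1\rho_0$, and assume that $S=T_1T_2$ has $2p$ distinct eigenvalues (condition E). By Bishop-type invariants $\gamma$ we mean integers $e_*,h_*,s_*\ge 0$ with $e_*+h_*+2s_*=p$ and numbers $\gamma_1,\dots,\gamma_{p-s_*}$ with $$0<\gamma_e<\tfrac12\ (1\le e\le e_*),\qquad \tfrac12<\gamma_h<\infty\ (e_*<h\le e_*+h_*),\qquad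 \operatorname{Re}\gamma_s<\tfrac12,\ \operatorname{Im}\gamma_s>0\ (e_*+h_*<s\le p-s_*).$$ Let $\boldsymbol\gamma_{e_*},\boldsymbol\gamma_{h_*},\boldsymbol\gamma_{s_*}$ be the diagonal matrices with these entries, $$\boldsymbol\gamma=\begin{pmatrix}\boldsymbol\gamma_{e_*}&0&0&0\\0&\boldsymbol\gamma_{h_*}&0&0\\0&0&0&\boldsymbol\gamma_{s_*}\\0&0&\mathbf I_{s_*}-\overline{\boldsymbol\gamma}_{s_*}&0\end{pmatrix},$$ and for $\mathbf B\in GL_p(\mathbf C)$ let $$Q_{\mathbf B,\boldsymbol\gamma}\colon\ z_{p+j}=L_j(z',\overline z')^2,\quad 1\le j\le p,\qquad (L_1,\dots,L_p)^t=\mathbf B(z'-2\boldsymbol\gamma\,\overline z').$$ Call $\gamma$ ordered if $\gamma_e$ is strictly decreasing in $e$, $\gamma_h$ is strictly increasing in $h$, and, with $\mu_s=\overline{\gamma_s^{-1}-1}$, the pairs $(\arg\mu_s,|\mu_s|)$ are strictly increasing in $s$ for the lexicographic order. Two submanifolds are holomorphically equivalent if a germ at $0$ of a biholomorphic map of $\mathbf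 C^{2p}$ fixing $0$ carries the germ at $0$ of one onto that of the other. Then: 1. $M$ is holomorphically equivalent to $Q_{\mathbf B,\boldsymbol\gamma}$ for some ordered Bishop-type invariants $\gamma$ and some $\mathbf B\in GL_p(\mathbf C)$. 2. The ordered invariants ($e_*,h_*,s_*$ and all the $\gamma_j$) are uniquely determined by $M$. 3. If $M$ is holomorphically equivalent to $Q_{\mathbf B,\boldsymbol\gamma}$ ($\gamma$ ordered or not), then for $\mathbf B'\in GL_p(\mathbf C)$, $M$ is holomorphically equivalent to $Q_{\mathbf B',\boldsymbol\gamma}$ if and only if $\mathbf B'=\mathbf C\mathbf B\mathbf R$ for some non-singular monomial matrix $\mathbf C$ (exactly one non-zero entry in each row and column) and some $\mathbf R=\operatorname{diag}(a_1,\dots,a_p)$ with all $a_j\ne0$, $a_e\in\mathbf R$, $a_h\in\mathbf R$ and $a_{s+s_*}=\overline{a_s}$. -/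

import Mathlib

open scoped ComplexConjugate

/-- `ℂ^p × ℂ^p`.  It is used both for the ambient space `ℂ^{2p}` with coordinates `(z', z'')` and for
the complexification of the quadric with its coordinates `(z', w')`. -/
abbrev C2 (p : ℕ) : Type := (Fin p → ℂ) × (Fin p → ℂ)

/-- The value `E(z', w')` of a system of `p` polynomials in `(z', w')`
(`Sum.inl k` stands for `z_k` and `Sum.inr k` for `w_k`). -/
noncomputable def evalE {p : ℕ} (E : Fin p → MvPolynomial (Fin p ⊕ Fin p) ℂ)
    (z w : Fin p → ℂ) : Fin p → ℂ :=
  fun j => MvPolynomial.eval (Sum.elim z w) (E j)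

/-- The real submanifold `z_{p+j} = E_j(z', conj z')`, `1 ≤ j ≤ p`, of `ℂ^{2p}`. -/
def quadricOf {p : ℕ} (E : Fin p → MvPolynomial (Fin p ⊕ Fin p) ℂ) : Set (C2 p) :=
  {x | x.2 = evalE E x.1 (star x.1)}

/-- `F` is the germ at `0` of a biholomorphic map fixing `0`. -/
def IsBiholGerm {p : ℕ} (F : C2 p → C2 p) : Prop :=
  AnalyticAt ℂ F 0 ∧ F 0 = 0 ∧ Function.Bijective (fderiv ℂ F 0)

/-- Holomorphic equivalence at the origin of two (germs of) submanifolds of `ℂ^{2p}`: some germ of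
biholomorphic map fixing `0` carries the germ of `M` at `0` onto the germ of `N` at `0`. -/
def HolEquiv {p : ℕ} (M N : Set (C2 p)) : Prop :=
  ∃ F : C2 p → C2 p, IsBiholGerm F ∧ ∀ᶠ x in nhds (0 : C2 p), x ∈ M ↔ F x ∈ N

/-- Condition B, `q⁻¹(0) = 0`, where `q_j(w') = E_j(0, w')`. -/
def ConditionB {p : ℕ} (E : Fin p → MvPolynomial (Fin p ⊕ Fin p) ℂ) : Prop :=
  ∀ w : Fin p → ℂ, evalE E 0 w = 0 → w = 0

/-- The projection `π₁` of the complexification to `z`-space, in the coordinates `(z', w')`: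
`(z', w') ↦ (z', E(z', w'))`. -/
noncomputable def pi1 {p : ℕ} (E : Fin p → MvPolynomial (Fin p ⊕ Fin p) ℂ) (x : C2 p) : C2 p :=
  (x.1, evalE E x.1 x.2)

/-- `τ` is (a representative of) a deck transformation of `π₁`: a germ at `0` of biholomorphic map
fixing `0` with `π₁ ∘ τ = π₁`. -/
def IsDeck {p : ℕ} (E : Fin p → MvPolynomial (Fin p ⊕ Fin p) ℂ) (τ : C2 p → C2 p) : Prop :=
  IsBiholGerm τ ∧ ∀ᶠ x in nhds (0 : C2 p), pi1 E (τ x) = pi1 E x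

/-- The set of deck transformations of `π₁`, as germs at `0`. -/
def deckGerms {p : ℕ} (E : Fin p → MvPolynomial (Fin p ⊕ Fin p) ℂ) :
    Set (Filter.Germ (nhds (0 : C2 p)) (C2 p)) :=
  {g | ∃ τ : C2 p → C2 p, IsDeck E τ ∧ (τ : Filter.Germ (nhds (0 : C2 p)) (C2 p)) = g}

/-- Condition D: `π₁` has `2^p` deck transformations. -/
def ConditionD {p : ℕ} (E : Fin p → MvPolynomial (Fin p ⊕ Fin p) ℂ) : Prop :=
  (deckGerms E).ncard = 2 ^ p

/-- The anti-holomorphic involution `ρ₀ (z', w') = (conj w', conj z')`. -/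
def rho0 (p : ℕ) : C2 p →ₛₗ[starRingEnd ℂ] C2 p where
  toFun x := (star x.2, star x.1)
  map_add' x y := by simp
  map_smul' c x := by ext <;> simp

/-- `T₁` is the Moser–Webster involution of `π₁`: the (linear part at `0` of the) deck
transformation of `π₁` whose set of fixed points has the smallest possible dimension, namely `p`. -/
def IsMoserWebster {p : ℕ} (E : Fin p → MvPolynomial (Fin p ⊕ Fin p) ℂ)
    (T₁ : C2 p →ₗ[ℂ] C2 p) : Prop :=
  ∃ τ : C2 p → C2 p, IsDeck E τ ∧ T₁ = (fderiv ℂ τ 0 : C2 p →ₗ[ℂ] C2 p) ∧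
    Module.finrank ℂ (LinearMap.ker (T₁ - LinearMap.id)) = p

/-- `T₂ = ρ₀ T₁ ρ₀`. -/
def secondInvolution {p : ℕ} (T₁ : C2 p →ₗ[ℂ] C2 p) : C2 p →ₗ[ℂ] C2 p :=
  (rho0 p).comp (T₁.comp (rho0 p))

/-- Condition E for `T₁`: the map `S = T₁ T₂` has `2p` distinct eigenvalues. -/
def ConditionE {p : ℕ} (T₁ : C2 p →ₗ[ℂ] C2 p) : Prop :=
  {μ : ℂ | Module.End.HasEigenvalue (T₁.comp (secondInvolution T₁)) μ}.ncard = 2 * p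

/-- The involution of the index set that fixes the first `e + h` indices and interchanges
`i` with `i + s` for the `s` indices `e + h ≤ i < e + h + s`. -/
def partner {p : ℕ} (e h s : ℕ) (hp : e + h + 2 * s = p) (i : Fin p) : Fin p :=
  if (i : ℕ) < e + h then i
  else if hi : (i : ℕ) < e + h + s then ⟨i + s, by omega⟩
  else ⟨i - s, by omega⟩

/-- Bishop-type invariants: `e` elliptic, `h` hyperbolic and `s` complex components with
`e + h + 2s = p`, and numbers `γ_i` (indexed from `0`) with `0 < γ_i < 1/2` for the elliptic indices,
`1/2 < γ_i < ∞` for the hyperbolic ones, `Re γ_i < 1/2`, `Im γ_i > 0` for the `s` complex indices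
`e + h ≤ i < e + h + s`; for those, `γ_{i+s}` is `1 - conj γ_i`. -/
structure BishopInvariants (p : ℕ) where
  e : ℕ
  h : ℕ
  s : ℕ
  sum_eq : e + h + 2 * s = p
  γ : Fin p → ℂ
  elliptic : ∀ i : Fin p, (i : ℕ) < e → ∃ r : ℝ, 0 < r ∧ r < 1 / 2 ∧ γ i = (r : ℂ)
  hyperbolic : ∀ i : Fin p, e ≤ (i : ℕ) → (i : ℕ) < e + h →
    ∃ r : ℝ, 1 / 2 < r ∧ γ i = (r : ℂ)
  complex : ∀ i : Fin p, e + h ≤ (i : ℕ) → (i : ℕ) < e + h + s →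
    (γ i).re < 1 / 2 ∧ 0 < (γ i).im
  complex_partner : ∀ i : Fin p, e + h ≤ (i : ℕ) → (i : ℕ) < e + h + s →
    γ (partner e h s sum_eq i) = 1 - conj (γ i)

namespace BishopInvariants

variable {p : ℕ}

/-- The partner of an index: itself in the elliptic and hyperbolic blocks, `i ↔ i + s` in the
complex block. -/
def prt (Γ : BishopInvariants p) : Fin p → Fin p := partner Γ.e Γ.h Γ.s Γ.sum_eq

/-- The block matrix with diagonal blocks `γ_e`, `γ_h` and the complex block
`[0, γ_s; 1 - conj γ_s, 0]`. -/
def mat (Γ : BishopInvariants p) : Matrix (Fin p) (Fin p) ℂ :=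
  Matrix.of fun i j => if j = Γ.prt i then Γ.γ i else 0

/-- The eigenvalue `μ = λ²` attached to a complex component, given by `γ = 1 / (1 + conj λ²)`. -/
noncomputable def mu (Γ : BishopInvariants p) (i : Fin p) : ℂ := conj ((Γ.γ i)⁻¹ - 1)

/-- The components of each type are listed in (strictly monotone) order.  With
`γ_e = 1 / (λ_e + 1/λ_e)`, `λ_e > 1`, and `γ_h = 1 / (2 cos (arg λ_h))`, this says that `λ_e` and
`arg λ_h` increase; the complex components are ordered lexicographically by
`arg λ_s²` and `|λ_s²|`. -/
def Ordered (Γ : BishopInvariants p) : Prop :=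
  (∀ i j : Fin p, i < j → (j : ℕ) < Γ.e → (Γ.γ j).re < (Γ.γ i).re) ∧
  (∀ i j : Fin p, Γ.e ≤ (i : ℕ) → i < j → (j : ℕ) < Γ.e + Γ.h → (Γ.γ i).re < (Γ.γ j).re) ∧
  (∀ i j : Fin p, Γ.e + Γ.h ≤ (i : ℕ) → i < j → (j : ℕ) < Γ.e + Γ.h + Γ.s →
    (Γ.mu i).arg < (Γ.mu j).arg ∨ ((Γ.mu i).arg = (Γ.mu j).arg ∧ ‖Γ.mu i‖ < ‖Γ.mu j‖))

end BishopInvariants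

/-- The quadric `Q_{B,γ}`: `z_{p+j} = L_j(z', conj z')²`, where `L = B (z' - 2 γ conj z')`. -/
def normalQuadric {p : ℕ} (B : Matrix (Fin p) (Fin p) ℂ) (Γ : BishopInvariants p) :
    Set (C2 p) :=
  {x | ∀ j, x.2 j = (B.mulVec (x.1 - (2 : ℂ) • Γ.mat.mulVec (star x.1))) j ^ 2}

/-- The monomial matrix `diag_ν(d)` with entry `d_i` at `(i, ν i)` and zeros elsewhere. -/
def diagPerm {p : ℕ} (ν : Equiv.Perm (Fin p)) (d : Fin p → ℂ) : Matrix (Fin p) (Fin p) ℂ :=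
  Matrix.of fun i j => if j = ν i then d i else 0

/-- The equivalence relation `B ∼ C B R` attached to `γ`: `C = diag_ν(d)` is any non-singular monomial
matrix and `R = diag(a)` is non-singular with `a_i` real for elliptic and hyperbolic indices and
`a_{i+s} = conj a_i` for complex ones. -/
def ExtendedBishopEquiv {p : ℕ} (Γ : BishopInvariants p) (B B' : Matrix (Fin p) (Fin p) ℂ) :
    Prop :=
  ∃ (ν : Equiv.Perm (Fin p)) (d a : Fin p → ℂ),
    (∀ i, d i ≠ 0) ∧ (∀ i, a i ≠ 0) ∧ (∀ i, a (Γ.prt i) = conj (a i)) ∧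
    B' = diagPerm ν d * B * Matrix.diagonal a

/-! Only the 2-jet of an equivalence matters. Comparing orders along curves in the graph of a
homogeneous quadratic map, holomorphic equivalence becomes `QuadEquiv`: linear changes of z' and of
z'' together with a holomorphic quadratic form in z' (`QuadEquiv.of_holEquiv`,
`QuadEquiv.holEquiv`). The rest is linear algebra.

Conditions B and D make the linear parts of the deck transformations 2^p distinct commuting
involutions. On the fibre z' = 0 they are all the sign changes in some basis, so q is diagonal there
(`exists_basis_diagonal`). Since T₁ reflects each fibre in a midpoint depending linearly on z',
completing the square turns M into the squares of the components of A₁z' + A₂z̄'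
(`QuadEquiv.exists_sqForm`).

Two such systems of squares are equivalent exactly when A₁'P = CA₁ and A₂'P̄ = CA₂ with C monomial
(`quadEquiv_sqForm_iff`). For normal quadrics this reads B'P = CB and Γ'P̄ = PΓ, with Γ the matrix
γ: the invariants are classified by consimilarity, which is governed by the spectrum of ΓΓ̄
(`delta`).

Existence: with K = A₂⁻¹A₁ and N = -½K⁻¹ one needs NP̄ = PΓ. Every eigenvalue μ of S lies over an
eigenvalue c = (1+μ)²/(4μ) of K̄K, at most two over each, so condition E gives NN̄ exactly p
distinct eigenvalues 1/(4c), none equal to 0 or 1/4. The antilinear map v ↦ Nv̄ exchanges the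
eigenlines of conjugate eigenvalues; a real eigenvalue is γ² with γ > 0, and a non-real pair is
γ(1-γ) and its conjugate (`exists_bishopInvariants`).

Uniqueness: P intertwines the diagonal matrices of the δ's, so their sets agree; δ determines the
type and γ, and the ordering fixes the enumeration (`eq_of_range_delta_eq`). When Γ' = Γ, P commutes
with a diagonal matrix of simple spectrum, hence is diagonal, and ΓP̄ = PΓ is the reality condition
on R = P⁻¹ (`extendedBishopEquiv_iff`). -/

section NormalForm

open Filter Topology Matrix

/-! ### Holomorphic equivalence of quadrics as an identity between 2-jets -/

/-- The graph of `𝓔`, as a subset of `ℂ^p × ℂ^p`. -/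
def graphSet {p : ℕ} (𝓔 : (Fin p → ℂ) → (Fin p → ℂ)) : Set (C2 p) := {x | x.2 = 𝓔 x.1}

/-- The relation between quadratic functions induced by a holomorphic equivalence of their graphs:
linear changes of the two groups of variables and the addition of a holomorphic quadratic form. -/
def QuadEquiv {p : ℕ} (𝓔 𝓔' : (Fin p → ℂ) → (Fin p → ℂ)) : Prop :=
  ∃ (P U : (Fin p → ℂ) ≃ₗ[ℂ] (Fin p → ℂ))
    (h : (Fin p → ℂ) →ₗ[ℂ] (Fin p → ℂ) →ₗ[ℂ] (Fin p → ℂ)),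
    ∀ x, 𝓔' (P x) = U (𝓔 x) + h x x

theorem QuadEquiv.symm {p : ℕ} {𝓔 𝓔' : (Fin p → ℂ) → (Fin p → ℂ)} (H : QuadEquiv 𝓔 𝓔') :
    QuadEquiv 𝓔' 𝓔 := by
  obtain ⟨P, U, h, H⟩ := H
  refine ⟨P.symm, U.symm,
    -((h.compl₁₂ P.symm.toLinearMap P.symm.toLinearMap).compr₂ U.symm.toLinearMap), fun x => ?_⟩
  have := congrArg U.symm (H (P.symm x))
  simp only [LinearEquiv.apply_symm_apply, map_add, LinearEquiv.symm_apply_apply] at this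
  simp [this]

theorem QuadEquiv.trans {p : ℕ} {𝓔 𝓔' 𝓔'' : (Fin p → ℂ) → (Fin p → ℂ)} (H : QuadEquiv 𝓔 𝓔')
    (H' : QuadEquiv 𝓔' 𝓔'') : QuadEquiv 𝓔 𝓔'' := by
  obtain ⟨P, U, h, H⟩ := H
  obtain ⟨P', U', h', H'⟩ := H'
  refine ⟨P.trans P', U.trans U',
    h.compr₂ U'.toLinearMap + h'.compl₁₂ P.toLinearMap P.toLinearMap, fun x => ?_⟩
  simp [H', H, add_assoc]

/-- A second-order expansion along the curves `t ↦ t • Y t`. -/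
theorem tendsto_second_order {X Z : Type*} [NormedAddCommGroup X] [NormedSpace ℂ X]
    [NormedAddCommGroup Z] [NormedSpace ℂ Z] {F : X → Z} {q : FormalMultilinearSeries ℂ X Z}
    (hq : HasFPowerSeriesAt F q 0) (h0 : F 0 = 0) {Y : ℝ → X} {Y₀ : X}
    (hY : Tendsto Y (𝓝[≠] 0) (𝓝 Y₀)) :
    Tendsto (fun t : ℝ => ((t : ℂ)⁻¹ ^ 2) • (F ((t : ℂ) • Y t) - (t : ℂ) • fderiv ℂ F 0 (Y t)
      - (t : ℂ) ^ 2 • q 2 (fun _ => Y t))) (𝓝[≠] 0) (𝓝 0) := by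
  have ht : Tendsto (fun t : ℝ => (t : ℂ)) (𝓝[≠] 0) (𝓝 0) := by
    have : Tendsto (fun t : ℝ => (t : ℂ)) (𝓝 0) (𝓝 ((0 : ℝ) : ℂ)) :=
      Complex.continuous_ofReal.tendsto 0
    simpa using this.mono_left nhdsWithin_le_nhds
  have hy : Tendsto (fun t : ℝ => (t : ℂ) • Y t) (𝓝[≠] 0) (𝓝 0) := by
    simpa using ht.smul hY
  have hO := (hq.isBigO_sub_partialSum_pow 3).comp_tendsto hy
  have hps : ∀ y, q.partialSum 3 y = fderiv ℂ F 0 y + q 2 (fun _ => y) := by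
    intro y
    have h00 : q 0 (fun _ => y) = 0 := by
      rw [← h0, ← hq.coeff_zero (fun _ => y)]
    have h11 : q 1 (fun _ => y) = fderiv ℂ F 0 y := by
      rw [hq.fderiv_eq, continuousMultilinearCurryFin1_apply]
      congr 1
    simp [FormalMultilinearSeries.partialSum, Finset.sum_range_succ, h00, h11]
  have hb : (fun t : ℝ => ((t : ℂ)⁻¹ ^ 2) • (F ((t : ℂ) • Y t) - (t : ℂ) • fderiv ℂ F 0 (Y t)
      - (t : ℂ) ^ 2 • q 2 (fun _ => Y t))) =O[𝓝[≠] 0] (fun t : ℝ => ‖t‖ * ‖Y t‖ ^ 3) := by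
    have h1 := (Asymptotics.isBigO_refl (fun t : ℝ => (t : ℂ)⁻¹ ^ 2) (𝓝[≠] 0)).norm_right.smul hO
    refine (h1.congr' ?_ ?_).trans ((Asymptotics.isBigO_refl _ _))
    · refine Eventually.of_forall fun t => ?_
      simp only [Function.comp, zero_add, hps, map_smul]
      rw [(q 2).map_smul_univ (fun _ => (t : ℂ)) (fun _ => Y t)]
      simp [sub_sub]
    · filter_upwards [self_mem_nhdsWithin] with t ht0
      have : ‖t‖ ≠ 0 := norm_ne_zero_iff.2 ht0
      simp only [Function.comp, norm_smul, norm_pow, norm_inv, Complex.norm_real, smul_eq_mul]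
      field_simp
  have hlim : Tendsto (fun t : ℝ => ‖t‖ * ‖Y t‖ ^ 3) (𝓝[≠] 0) (𝓝 0) := by
    have : Tendsto (fun t : ℝ => ‖t‖) (𝓝[≠] 0) (𝓝 0) := by
      have : Tendsto (fun t : ℝ => ‖t‖) (𝓝 0) (𝓝 0) := by
        simpa using (continuous_norm (E := ℝ)).tendsto 0
      exact this.mono_left nhdsWithin_le_nhds
    simpa using this.mul (hY.norm.pow 3)
  exact hb.trans_tendsto hlim

theorem exists_bilinear_of_multilinear {X Z : Type*} [NormedAddCommGroup X] [NormedSpace ℂ X]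
    [NormedAddCommGroup Z] [NormedSpace ℂ Z] (f : X [×2]→L[ℂ] Z) :
    ∃ h : X →ₗ[ℂ] X →ₗ[ℂ] Z, ∀ x, h x x = f (fun _ => x) := by
  have hu : ∀ x z : X, Function.update ![x, 0] 1 z = ![x, z] := by
    intro x z
    ext i
    fin_cases i <;> rfl
  refine ⟨LinearMap.mk₂ ℂ (fun x y => f ![x, y]) ?_ ?_ ?_ ?_, fun x => ?_⟩
  · intro x x' y
    exact f.cons_add ![y] x x'
  · intro c x y
    exact f.cons_smul ![y] c x
  · intro x y y'
    have := f.map_update_add ![x, 0] 1 y y'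
    rwa [hu, hu, hu] at this
  · intro c x y
    have := f.map_update_smul ![x, 0] 1 c y
    rwa [hu, hu] at this
  · change f ![x, x] = _
    congr 1
    ext i
    fin_cases i <;> rfl

/-- P and U are the diagonal blocks of the derivative of F, and h comes from its second Taylor
coefficient. The order-one terms show that the derivative preserves z'' = 0; the order-two terms
give the identity. -/
theorem QuadEquiv.of_holEquiv {p : ℕ} {𝓔 𝓔' : (Fin p → ℂ) → (Fin p → ℂ)}
    (h𝓔 : ∀ (t : ℝ) x, 𝓔 ((t : ℂ) • x) = (t : ℂ) ^ 2 • 𝓔 x)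
    (h𝓔' : ∀ (t : ℝ) x, 𝓔' ((t : ℂ) • x) = (t : ℂ) ^ 2 • 𝓔' x) (hc : Continuous 𝓔')
    (H : HolEquiv (graphSet 𝓔) (graphSet 𝓔')) : QuadEquiv 𝓔 𝓔' := by
  obtain ⟨F, ⟨hA, h0, hbij⟩, hF⟩ := H
  obtain ⟨q, hq⟩ := hA
  set D := fderiv ℂ F 0 with hD
  have key : ∀ x, (D (x, 0)).2 = 0 ∧
      𝓔' (D (x, 0)).1 = (D (0, 𝓔 x)).2 + (q 2 (fun _ => (x, 0))).2 := by
    intro x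
    have ht : Tendsto (fun t : ℝ => (t : ℂ)) (𝓝[≠] 0) (𝓝 0) := by
      have : Tendsto (fun t : ℝ => (t : ℂ)) (𝓝 0) (𝓝 ((0 : ℝ) : ℂ)) :=
        Complex.continuous_ofReal.tendsto 0
      simpa using this.mono_left nhdsWithin_le_nhds
    -- Chosen so that t • Y t = (t x, t² 𝓔 x) stays on the graph.
    let Y : ℝ → C2 p := fun t => (x, (t : ℂ) • 𝓔 x)
    have hY : Tendsto Y (𝓝[≠] 0) (𝓝 (x, 0)) := by
      have : Tendsto (fun t : ℝ => (t : ℂ) • 𝓔 x) (𝓝[≠] 0) (𝓝 0) := by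
        simpa using ht.smul_const (𝓔 x)
      exact tendsto_const_nhds.prodMk_nhds this
    have hy : Tendsto (fun t : ℝ => (t : ℂ) • Y t) (𝓝[≠] 0) (𝓝 0) := by
      simpa using ht.smul hY
    have h2 := tendsto_second_order hq h0 hY
    have hDY : Tendsto (fun t => D (Y t)) (𝓝[≠] 0) (𝓝 (D (x, 0))) :=
      (D.continuous.tendsto _).comp hY
    have hqY : Tendsto (fun t => q 2 (fun _ => Y t)) (𝓝[≠] 0) (𝓝 (q 2 (fun _ => (x, 0)))) :=
      ((q 2).cont.tendsto _).comp (tendsto_pi_nhds.2 fun _ => hY)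
    have h1 : Tendsto (fun t : ℝ => (t : ℂ)⁻¹ • F ((t : ℂ) • Y t)) (𝓝[≠] 0) (𝓝 (D (x, 0))) := by
      have := ((ht.smul h2).add hDY).add (ht.smul hqY)
      simp only [smul_zero, zero_smul, zero_add, add_zero] at this
      refine this.congr' ?_
      filter_upwards [self_mem_nhdsWithin] with t ht0
      have ht0' : (t : ℂ) ≠ 0 := by exact_mod_cast ht0
      simp only [smul_sub, smul_smul, ← hD]
      have e1 : (t : ℂ) * (t : ℂ)⁻¹ ^ 2 = (t : ℂ)⁻¹ := by field_simp
      have e2 : (t : ℂ) * ((t : ℂ)⁻¹ ^ 2 * t) = 1 := by field_simp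
      have e3 : (t : ℂ) * ((t : ℂ)⁻¹ ^ 2 * t ^ 2) = t := by field_simp
      rw [e1, e2, e3, one_smul]
      abel
    have h3 : Tendsto (fun t : ℝ => (t : ℂ)⁻¹ ^ 2 • (F ((t : ℂ) • Y t)).2) (𝓝[≠] 0)
        (𝓝 (𝓔' (D (x, 0)).1)) := by
      have := (hc.tendsto _).comp ((continuous_fst.tendsto _).comp h1)
      refine this.congr' ?_
      filter_upwards [hy.eventually hF] with t ht
      have hmem : (t : ℂ) • Y t ∈ graphSet 𝓔 := by
        change (t : ℂ) • (t : ℂ) • 𝓔 x = 𝓔 ((t : ℂ) • x)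
        rw [h𝓔, smul_smul, pow_two]
      have := ht.1 hmem
      simp only [graphSet, Set.mem_ofPred_eq] at this
      simp only [Function.comp, Prod.smul_fst, this]
      rw [← Complex.ofReal_inv, h𝓔']
    have h4 : Tendsto (fun t : ℝ => (t : ℂ)⁻¹ • (D (Y t)).2) (𝓝[≠] 0)
        (𝓝 (𝓔' (D (x, 0)).1 - (q 2 (fun _ => (x, 0))).2)) := by
      have := (h3.sub ((continuous_snd.tendsto _).comp h2)).sub
        ((continuous_snd.tendsto _).comp hqY)
      simp only [Prod.snd_zero, sub_zero] at this
      refine this.congr' ?_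
      filter_upwards [self_mem_nhdsWithin] with t ht0
      have ht0' : (t : ℂ) ≠ 0 := by exact_mod_cast ht0
      simp only [Function.comp, Prod.smul_snd, Prod.snd_sub, smul_sub, smul_smul, ← hD]
      have e2 : (t : ℂ)⁻¹ ^ 2 * t = (t : ℂ)⁻¹ := by field_simp
      have e3 : (t : ℂ)⁻¹ ^ 2 * t ^ 2 = 1 := by field_simp
      rw [e2, e3, one_smul]
      abel
    have hsplit : ∀ t, (D (Y t)).2 = (D (x, 0)).2 + (t : ℂ) • (D (0, 𝓔 x)).2 := by
      intro t
      have : Y t = (x, 0) + (t : ℂ) • (0, 𝓔 x) := by simp [Y]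
      rw [this, map_add, map_smul]
      rfl
    -- Since t⁻¹ (D (Y t)).2 converges, (D (Y t)).2 tends to 0.
    have h5 : (D (x, 0)).2 = 0 := by
      have h6 := ht.smul h4
      have h7 : Tendsto (fun t => (D (Y t)).2) (𝓝[≠] 0) (𝓝 (D (x, 0)).2) :=
        (continuous_snd.tendsto _).comp hDY
      rw [zero_smul] at h6
      refine tendsto_nhds_unique h7 (h6.congr' ?_)
      filter_upwards [self_mem_nhdsWithin] with t ht0
      have ht0' : (t : ℂ) ≠ 0 := by exact_mod_cast ht0
      rw [smul_smul, mul_inv_cancel₀ ht0', one_smul]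
    refine ⟨h5, ?_⟩
    have h8 : Tendsto (fun t : ℝ => (t : ℂ)⁻¹ • (D (Y t)).2) (𝓝[≠] 0) (𝓝 (D (0, 𝓔 x)).2) := by
      refine tendsto_const_nhds.congr' ?_
      filter_upwards [self_mem_nhdsWithin] with t ht0
      have ht0' : (t : ℂ) ≠ 0 := by exact_mod_cast ht0
      rw [hsplit, h5, zero_add, smul_smul, inv_mul_cancel₀ ht0', one_smul]
    rw [tendsto_nhds_unique h8 h4]
    abel
  let P₀ : (Fin p → ℂ) →ₗ[ℂ] (Fin p → ℂ) :=
    (LinearMap.fst ℂ _ _).comp (D.toLinearMap.comp (LinearMap.inl ℂ _ _))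
  let U₀ : (Fin p → ℂ) →ₗ[ℂ] (Fin p → ℂ) :=
    (LinearMap.snd ℂ _ _).comp (D.toLinearMap.comp (LinearMap.inr ℂ _ _))
  have hP : Function.Injective P₀ := by
    rw [← LinearMap.ker_eq_bot, LinearMap.ker_eq_bot']
    intro x hx
    have : D (x, 0) = 0 := Prod.ext hx (key x).1
    have := hbij.1 (this.trans (map_zero D).symm)
    exact congrArg Prod.fst this
  have hU : Function.Surjective U₀ := by
    intro y
    obtain ⟨⟨a, b⟩, hab⟩ := hbij.2 (0, y)
    refine ⟨b, ?_⟩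
    have : ((a, b) : C2 p) = (a, 0) + (0, b) := by simp
    rw [this, map_add] at hab
    have := congrArg Prod.snd hab
    simp only [Prod.snd_add, (key a).1, zero_add] at this
    exact this
  obtain ⟨h, hh⟩ := exists_bilinear_of_multilinear (q 2)
  refine ⟨LinearEquiv.ofInjectiveEndo P₀ hP, LinearEquiv.ofBijective U₀
    ⟨LinearMap.injective_iff_surjective.2 hU, hU⟩,
    (h.compl₁₂ (LinearMap.inl ℂ _ _) (LinearMap.inl ℂ _ _)).compr₂ (LinearMap.snd ℂ _ _), fun x => ?_⟩
  have := (key x).2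
  simp only [LinearMap.compr₂_apply, LinearMap.compl₁₂_apply, hh]
  exact this

/-- The polynomial map (z', z'') ↦ (P z', U z'' + h(z', z')) carries one graph onto the other
globally. -/
theorem QuadEquiv.holEquiv {p : ℕ} {𝓔 𝓔' : (Fin p → ℂ) → (Fin p → ℂ)} (H : QuadEquiv 𝓔 𝓔') :
    HolEquiv (graphSet 𝓔) (graphSet 𝓔') := by
  obtain ⟨P, U, h, H⟩ := H
  let hc : (Fin p → ℂ) →L[ℂ] (Fin p → ℂ) →L[ℂ] (Fin p → ℂ) :=
    LinearMap.toContinuousLinearMap ((LinearMap.toContinuousLinearMap :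
      ((Fin p → ℂ) →ₗ[ℂ] (Fin p → ℂ)) ≃ₗ[ℂ] _).toLinearMap.comp h)
  have hhc : ∀ x y, hc x y = h x y := fun _ _ => rfl
  let L : C2 p →L[ℂ] C2 p := LinearMap.toContinuousLinearMap
    (P.toLinearMap.prodMap U.toLinearMap)
  have hL : ∀ x, L x = (P x.1, U x.2) := fun _ => rfl
  have hd : HasFDerivAt (fun x : C2 p => L x + (0, hc x.1 x.1)) L 0 := by
    have h1 : HasFDerivAt (fun x : C2 p => hc x.1 x.1) (0 : C2 p →L[ℂ] (Fin p → ℂ)) 0 := by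
      have := (hc.isBoundedBilinearMap.hasFDerivAt ((0 : C2 p).1, (0 : C2 p).1)).comp (0 : C2 p)
        ((hasFDerivAt_fst (𝕜 := ℂ) (p := (0 : C2 p))).prodMk
          (hasFDerivAt_fst (𝕜 := ℂ) (p := (0 : C2 p))))
      refine this.congr_fderiv ?_
      ext <;> simp
    have := L.hasFDerivAt.add ((hasFDerivAt_const (0 : Fin p → ℂ) (0 : C2 p)).prodMk h1)
    refine this.congr_fderiv ?_
    ext <;> simp
  refine ⟨fun x => L x + (0, hc x.1 x.1), ⟨?_, by simp, ?_⟩, Eventually.of_forall fun x => ?_⟩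
  · have h1 : AnalyticAt ℂ (fun x : C2 p => hc x.1 x.1) 0 := by
      have : AnalyticAt ℂ (fun x : (Fin p → ℂ) × (Fin p → ℂ) => hc x.1 x.2) ((0 : C2 p).1, (0 : C2 p).1) :=
        ContinuousLinearMap.analyticAt_bilinear hc _
      exact this.comp₂ analyticAt_fst analyticAt_fst
    exact (L.analyticAt 0).add (analyticAt_const.prod h1)
  · rw [hd.fderiv]
    exact ⟨fun x y hxy => by
      rw [hL, hL, Prod.mk.injEq] at hxy
      exact Prod.ext (P.injective hxy.1) (U.injective hxy.2), fun y =>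
      ⟨(P.symm y.1, U.symm y.2), by simp [hL]⟩⟩
  · simp only [graphSet, Set.mem_ofPred_eq, hL, hhc, Prod.mk_add_mk, add_zero, H]
    rw [add_left_inj, U.injective.eq_iff]

/-! ### Homogeneous quadratic polynomials as diagonals of bilinear maps -/

theorem exists_bilinear_monomial {σ : Type*} {d : σ →₀ ℕ} (hd : d.degree = 2) (c : ℂ) :
    ∃ b : (σ → ℂ) →ₗ[ℂ] (σ → ℂ) →ₗ[ℂ] ℂ,
      ∀ x, MvPolynomial.eval x (MvPolynomial.monomial d c) = b x x := by
  classical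
  have h0 : d ≠ 0 := by
    rintro rfl
    simp at hd
  obtain ⟨i, hi⟩ := Finsupp.ne_iff.1 h0
  have hi' : Finsupp.single i 1 ≤ d := by
    rw [Finsupp.single_le_iff]
    exact Nat.one_le_iff_ne_zero.2 hi
  obtain ⟨d', rfl⟩ := exists_add_of_le hi'
  have hd' : d'.degree = 1 := by
    have : (Finsupp.single i 1 + d').degree = 1 + d'.degree := by
      rw [map_add, Finsupp.degree_single]
    omega
  have h0' : d' ≠ 0 := by
    rintro rfl
    simp at hd'
  obtain ⟨j, hj⟩ := Finsupp.ne_iff.1 h0'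
  have hj' : Finsupp.single j 1 ≤ d' := by
    rw [Finsupp.single_le_iff]
    exact Nat.one_le_iff_ne_zero.2 hj
  obtain ⟨d'', rfl⟩ := exists_add_of_le hj'
  have hd'' : d'' = 0 := by
    have : (Finsupp.single j 1 + d'').degree = 1 + d''.degree := by
      rw [map_add, Finsupp.degree_single]
    rw [← Finsupp.degree_eq_zero_iff]
    omega
  subst hd''
  refine ⟨(c • (LinearMap.proj i : (σ → ℂ) →ₗ[ℂ] ℂ)).smulRight (LinearMap.proj j), fun x => ?_⟩
  rw [MvPolynomial.eval_monomial, add_zero, Finsupp.prod_add_index' (by simp) (by simp [pow_add])]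
  simp [mul_assoc]

/-- The value of a homogeneous quadratic polynomial is given by a bilinear form. -/
theorem exists_bilinear_of_isHomogeneous {σ : Type*} {e : MvPolynomial σ ℂ}
    (he : e.IsHomogeneous 2) :
    ∃ b : (σ → ℂ) →ₗ[ℂ] (σ → ℂ) →ₗ[ℂ] ℂ, ∀ x, MvPolynomial.eval x e = b x x := by
  classical
  have : ∀ d, ∃ b : (σ → ℂ) →ₗ[ℂ] (σ → ℂ) →ₗ[ℂ] ℂ,
      ∀ x, MvPolynomial.eval x (MvPolynomial.monomial d (e.coeff d)) = b x x := by
    intro d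
    by_cases hd : e.coeff d = 0
    · exact ⟨0, fun x => by simp [hd]⟩
    · refine exists_bilinear_monomial ?_ _
      have := he hd
      rwa [Finsupp.degree_eq_weight_one]
  choose b hb using this
  refine ⟨∑ d ∈ e.support, b d, fun x => ?_⟩
  conv_lhs => rw [e.as_sum, map_sum]
  simp [hb, LinearMap.sum_apply]

theorem exists_bilinear_evalE {p : ℕ} {E : Fin p → MvPolynomial (Fin p ⊕ Fin p) ℂ}
    (hE : ∀ j, (E j).IsHomogeneous 2) :
    ∃ b : C2 p →ₗ[ℂ] C2 p →ₗ[ℂ] (Fin p → ℂ), ∀ x : C2 p, evalE E x.1 x.2 = b x x := by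
  choose b hb using fun j => exists_bilinear_of_isHomogeneous (hE j)
  let e : C2 p →ₗ[ℂ] (Fin p ⊕ Fin p → ℂ) :=
    { toFun := fun x => Sum.elim x.1 x.2
      map_add' := fun x y => by ext (i | i) <;> rfl
      map_smul' := fun c x => by ext (i | i) <;> rfl }
  refine ⟨LinearMap.mk₂ ℂ (fun x y j => b j (e x) (e y)) ?_ ?_ ?_ ?_, fun x => ?_⟩
  · intros; ext; simp
  · intros; ext; simp
  · intros; ext; simp
  · intros; ext; simp
  · ext j
    exact hb j _

theorem continuous_evalE {p : ℕ} (E : Fin p → MvPolynomial (Fin p ⊕ Fin p) ℂ) :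
    Continuous fun x : C2 p => evalE E x.1 x.2 := by
  refine continuous_pi fun j => ?_
  refine (MvPolynomial.continuous_eval (E j)).comp (continuous_pi fun i => ?_)
  cases i with
  | inl i => exact (continuous_apply i).comp continuous_fst
  | inr i => exact (continuous_apply i).comp continuous_snd

theorem evalE_smul {p : ℕ} {E : Fin p → MvPolynomial (Fin p ⊕ Fin p) ℂ}
    (hE : ∀ j, (E j).IsHomogeneous 2) (t : ℂ) (z w : Fin p → ℂ) :
    evalE E (t • z) (t • w) = t ^ 2 • evalE E z w := by
  obtain ⟨b, hb⟩ := exists_bilinear_evalE hE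
  have h1 := hb (t • (z, w))
  have h2 := hb (z, w)
  simp only [Prod.smul_mk] at h1
  rw [h1, h2, ← Prod.smul_mk, map_smul, map_smul, LinearMap.smul_apply, smul_smul, pow_two]

/-! ### Germs of deck transformations and their linear parts -/

theorem eventually_eq_of_hasStrictFDerivAt {X α : Type*} [NormedAddCommGroup X] [NormedSpace ℂ X]
    [CompleteSpace X] {ψ : X → X} {L : X ≃L[ℂ] X} (hψ : HasStrictFDerivAt ψ (L : X →L[ℂ] X) 0)
    {l : Filter α} {f g : α → X} (hf : Tendsto f l (𝓝 0)) (hg : Tendsto g l (𝓝 0))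
    (h : ∀ᶠ x in l, ψ (f x) = ψ (g x)) : f =ᶠ[l] g := by
  filter_upwards [hf.eventually hψ.eventually_left_inverse,
    hg.eventually hψ.eventually_left_inverse, h] with x h1 h2 h3
  rw [← h1, ← h2, h3]

namespace IsBiholGerm

variable {p : ℕ} {σ τ : C2 p → C2 p}

theorem tendsto (hσ : IsBiholGerm σ) : Tendsto σ (𝓝 0) (𝓝 0) := by
  simpa [hσ.2.1] using hσ.1.continuousAt.tendsto

theorem hasStrictFDerivAt (hσ : IsBiholGerm σ) : HasStrictFDerivAt σ (fderiv ℂ σ 0) 0 :=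
  hσ.1.hasStrictFDerivAt

theorem comp (hσ : IsBiholGerm σ) (hτ : IsBiholGerm τ) : IsBiholGerm (σ ∘ τ) ∧
    fderiv ℂ (σ ∘ τ) 0 = (fderiv ℂ σ 0).comp (fderiv ℂ τ 0) := by
  have h : fderiv ℂ (σ ∘ τ) 0 = (fderiv ℂ σ 0).comp (fderiv ℂ τ 0) := by
    rw [fderiv_comp, hτ.2.1]
    · rw [hτ.2.1]; exact hσ.1.differentiableAt
    · exact hτ.1.differentiableAt
  refine ⟨⟨AnalyticAt.comp (by rw [hτ.2.1]; exact hσ.1) hτ.1, by simp [hτ.2.1, hσ.2.1], ?_⟩, h⟩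
  rw [h]
  exact hσ.2.2.comp hτ.2.2

theorem linear {L : C2 p →L[ℂ] C2 p} (hL : Function.Bijective L) : IsBiholGerm L :=
  ⟨L.analyticAt 0, map_zero L, by rwa [L.hasFDerivAt.fderiv]⟩

theorem eventually_eq {α : Type*} (hσ : IsBiholGerm σ)
    {l : Filter α} {f g : α → C2 p} (hf : Tendsto f l (𝓝 0)) (hg : Tendsto g l (𝓝 0))
    (h : ∀ᶠ x in l, σ (f x) = σ (g x)) : f =ᶠ[l] g := by
  let L : C2 p ≃L[ℂ] C2 p :=
    (LinearEquiv.ofBijective (fderiv ℂ σ 0 : C2 p →ₗ[ℂ] C2 p) hσ.2.2).toContinuousLinearEquiv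
  exact eventually_eq_of_hasStrictFDerivAt (L := L) hσ.hasStrictFDerivAt hf hg h

end IsBiholGerm

namespace IsDeck

variable {p : ℕ} {E : Fin p → MvPolynomial (Fin p ⊕ Fin p) ℂ} {σ τ : C2 p → C2 p}

theorem comp (hσ : IsDeck E σ) (hτ : IsDeck E τ) : IsDeck E (σ ∘ τ) := by
  refine ⟨(hσ.1.comp hτ.1).1, ?_⟩
  filter_upwards [hτ.1.tendsto.eventually hσ.2, hτ.2] with x h1 h2
  rw [Function.comp, h1, h2]

theorem iterate (hσ : IsDeck E σ) (h1 : fderiv ℂ σ 0 = ContinuousLinearMap.id ℂ _) (n : ℕ) :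
    IsDeck E (σ^[n]) ∧ fderiv ℂ (σ^[n]) 0 = ContinuousLinearMap.id ℂ _ := by
  induction n with
  | zero =>
    have : IsBiholGerm (ContinuousLinearMap.id ℂ (C2 p)) :=
      IsBiholGerm.linear Function.bijective_id
    exact ⟨⟨this, Eventually.of_forall fun _ => rfl⟩, fderiv_id⟩
  | succ n ih =>
    rw [Function.iterate_succ]
    refine ⟨ih.1.comp hσ, ?_⟩
    rw [(ih.1.1.comp hσ.1).2, ih.2, h1]
    rfl

/-- When there are only finitely many deck germs, one that is tangent to the identity is the
identity. -/
theorem eventually_eq_id (hfin : (deckGerms E).Finite) (hσ : IsDeck E σ)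
    (h1 : fderiv ℂ σ 0 = ContinuousLinearMap.id ℂ _) : σ =ᶠ[𝓝 0] id := by
  have hit := hσ.iterate h1
  obtain ⟨m, -, n, -, hmn, heq⟩ := Set.infinite_univ.exists_ne_map_eq_of_mapsTo
    (f := fun n : ℕ => ((σ^[n] : C2 p → C2 p) : Germ (𝓝 (0 : C2 p)) (C2 p)))
    (t := deckGerms E) (fun n _ => ⟨_, (hit n).1, rfl⟩) hfin
  wlog hlt : m < n generalizing m n
  · exact this n m hmn.symm heq.symm (lt_of_le_of_ne (not_lt.1 hlt) hmn.symm)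
  obtain ⟨k, rfl⟩ := Nat.exists_eq_add_of_lt hlt
  -- Two iterates coincide as germs; local injectivity of `σ^[m]` cancels the common factor.
  have hk : σ^[k + 1] =ᶠ[𝓝 0] id := by
    refine (hit m).1.1.eventually_eq (hit (k + 1)).1.1.tendsto tendsto_id ?_
    filter_upwards [Germ.coe_eq.1 heq] with x hx
    rw [← Function.iterate_add_apply, id, hx, add_assoc]
  let L : C2 p ≃L[ℂ] C2 p := ContinuousLinearEquiv.smulLeft
    (Units.mk0 ((k + 1 : ℕ) : ℂ) (Nat.cast_ne_zero.2 (Nat.succ_ne_zero k)))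
  -- The orbit sum ψ satisfies ψ ∘ σ = ψ because `σ^[k + 1]` is the identity, and its derivative (k
  -- + 1)·id is invertible; local injectivity of ψ then gives σ = id.
  have hψ : HasStrictFDerivAt (fun x => ∑ i ∈ Finset.range (k + 1), σ^[i] x)
      (L : C2 p →L[ℂ] C2 p) 0 := by
    have := HasStrictFDerivAt.fun_sum (u := Finset.range (k + 1))
      (fun i _ => (hit i).1.1.hasStrictFDerivAt)
    refine this.congr_fderiv ?_
    simp only [(hit _).2, Finset.sum_const, Finset.card_range]
    ext x <;> simp [L, Units.smul_def, add_mul]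
  refine eventually_eq_of_hasStrictFDerivAt hψ hσ.1.tendsto tendsto_id ?_
  filter_upwards [hk] with x hx
  simp only [id, ← Function.iterate_succ_apply]
  have := Finset.sum_range_succ' (fun i => σ^[i] x) (k + 1)
  rw [Finset.sum_range_succ, hx] at this
  simpa using this.symm

/-- The linear part of a deck transformation is a deck transformation. -/
theorem linear_part (hE : ∀ j, (E j).IsHomogeneous 2) (hτ : IsDeck E τ) (x : C2 p) :
    pi1 E (fderiv ℂ τ 0 x) = pi1 E x := by
  have ht : Tendsto (fun t : ℝ => (t : ℂ) • x) (𝓝[≠] 0) (𝓝 0) := by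
    have : Tendsto (fun t : ℝ => (t : ℂ) • x) (𝓝 0) (𝓝 (((0 : ℝ) : ℂ) • x)) :=
      (Complex.continuous_ofReal.smul continuous_const).tendsto 0
    simpa using this.mono_left nhdsWithin_le_nhds
  -- The linear part is the limit of rescalings of τ, and π₁ is homogeneous of weight 1 in its first
  -- component and 2 in its second, so the relation survives rescaling.
  have h1 : Tendsto (fun t : ℝ => (t : ℂ)⁻¹ • τ ((t : ℂ) • x)) (𝓝[≠] 0) (𝓝 (fderiv ℂ τ 0 x)) := by
    have hline : HasDerivAt (fun t : ℝ => (t : ℂ) • x) x 0 := by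
      simpa using (Complex.ofRealCLM.hasDerivAt (x := 0)).smul_const x
    have hd : HasFDerivAt τ ((fderiv ℂ τ 0).restrictScalars ℝ) (((0 : ℝ) : ℂ) • x) := by
      rw [Complex.ofReal_zero, zero_smul]
      exact hτ.1.1.differentiableAt.hasFDerivAt.restrictScalars ℝ
    have := (hd.comp_hasDerivAt (0 : ℝ) hline).tendsto_slope_zero
    refine this.congr' (Eventually.of_forall fun t => ?_)
    simp only [zero_add, Complex.ofReal_zero, Function.comp, zero_smul, hτ.1.2.1, sub_zero]
    rw [← Complex.ofReal_inv, Complex.coe_smul, Complex.coe_smul]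
  have hc : Continuous (pi1 E) := continuous_fst.prodMk (continuous_evalE E)
  have h2 := (hc.tendsto _).comp h1
  refine tendsto_nhds_unique h2 (tendsto_const_nhds.congr' ?_)
  filter_upwards [ht.eventually hτ.2, self_mem_nhdsWithin] with t h3 ht0
  have ht0' : (t : ℂ) ≠ 0 := by exact_mod_cast ht0
  have h4 := congrArg Prod.fst h3
  have h5 := congrArg Prod.snd h3
  simp only [pi1, Prod.smul_fst, Prod.smul_snd, evalE_smul hE] at h4 h5
  simp only [Function.comp, pi1, Prod.smul_fst, Prod.smul_snd, evalE_smul hE]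
  rw [h5, h4, smul_smul, smul_smul, inv_mul_cancel₀ ht0', one_smul, ← mul_pow, inv_mul_cancel₀ ht0',
    one_pow, one_smul]

end IsDeck

/-! ### Commuting involutions and diagonal quadratic forms -/

/-- A family of `2^p` distinct commuting involutions of a `p`-dimensional space consists of all the
sign changes in a suitable basis. -/
theorem exists_basis_of_commuting_involutions {p : ℕ} {V ι : Type*} [AddCommGroup V] [Module ℂ V]
    [FiniteDimensional ℂ V] [Fintype ι] (hV : Module.finrank ℂ V = p)
    (hι : Fintype.card ι = 2 ^ p) (D : ι → Module.End ℂ V)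
    (hinj : Function.Injective D) (hinv : ∀ i, D i * D i = 1)
    (hcomm : ∀ i j, Commute (D i) (D j)) :
    ∃ v : Module.Basis (Fin p) ℂ V, ∀ j, ∃ i, D i (v j) = - v j ∧ ∀ k ≠ j, D i (v k) = v k := by
  classical
  have hmax : ∀ i μ, (D i).maxGenEigenspace μ = (D i).eigenspace μ := by
    intro i μ
    have hss : (D i).IsSemisimple := by
      refine Module.End.isSemisimple_of_squarefree_aeval_eq_zero
        (p := (Polynomial.X ^ 2 - Polynomial.C 1 : Polynomial ℂ)) ?_ ?_
      · exact (Polynomial.separable_X_pow_sub_C (1 : ℂ) (by norm_num) one_ne_zero).squarefree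
      · simp [pow_two, hinv]
    exact hss.isFinitelySemisimple.maxGenEigenspace_eq_eigenspace μ
  -- Joint eigenspaces of the commuting involutions span, so the vectors on which every `D i` acts
  -- by ±1 span and contain a basis.
  have htop := Module.End.iSup_iInf_maxGenEigenspace_eq_top_of_iSup_maxGenEigenspace_eq_top_of_commute
    D (fun i j _ => hcomm i j) (fun i => Module.End.iSup_maxGenEigenspace_eq_top _)
  simp only [hmax] at htop
  set s : Set V := {v | ∀ i, D i v = v ∨ D i v = -v} with hs
  have hspan : ⊤ ≤ Submodule.span ℂ s := by
    rw [← htop]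
    refine iSup_le fun χ v hv => ?_
    refine Submodule.subset_span fun i => ?_
    have h1 : D i v = χ i • v := Module.End.mem_eigenspace_iff.1 ((Submodule.mem_iInf _).1 hv i)
    have h2 : (χ i * χ i) • v = v := by
      have := congrArg (fun f => f v) (hinv i)
      simpa [h1, smul_smul] using this
    have h3 : (χ i * χ i - 1) • v = 0 := by rw [sub_smul, h2, one_smul, sub_self]
    rcases smul_eq_zero.1 h3 with h4 | h4
    · rcases mul_self_eq_one_iff.1 (sub_eq_zero.1 h4) with h5 | h5
      · left; rw [h1, h5, one_smul]
      · right; rw [h1, h5, neg_one_smul]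
    · left; rw [h4, map_zero]
  let v₀ := Module.Basis.ofSpan hspan
  have : Finite ((linearIndepOn_empty ℂ id).extend (Set.empty_subset s) : Set V) :=
    Module.Finite.finite_basis v₀
  have : Fintype ((linearIndepOn_empty ℂ id).extend (Set.empty_subset s) : Set V) :=
    Fintype.ofFinite _
  let v : Module.Basis (Fin p) ℂ V :=
    v₀.reindex (Fintype.equivFinOfCardEq (by rw [← hV, Module.finrank_eq_card_basis v₀]))
  have hv : ∀ j, v j ∈ s := by
    intro j
    rw [Module.Basis.reindex_apply]
    exact Module.Basis.ofSpan_subset hspan (Set.mem_range_self _)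
  -- In the joint eigenbasis an involution is a sign vector; 2^p distinct ones exhaust the sign
  -- vectors, so the change of a single sign occurs.
  let ε : ι → Fin p → Bool := fun i j => decide (D i (v j) = v j)
  have hε : Function.Injective ε := by
    intro i i' h
    refine hinj (v.ext fun j => ?_)
    have h1 := congrFun h j
    simp only [ε, decide_eq_decide] at h1
    rcases hv j i with h2 | h2
    · rw [h2, h1.1 h2]
    · rcases hv j i' with h3 | h3
      · rw [h3, h1.2 h3]
      · rw [h2, h3]
  have hbij : Function.Bijective ε :=
    (Fintype.bijective_iff_injective_and_card ε).2 ⟨hε, by simp [hι]⟩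
  refine ⟨v, fun j => ?_⟩
  obtain ⟨i, hi⟩ := hbij.2 (fun k => decide (k ≠ j))
  refine ⟨i, ?_, fun k hk => ?_⟩
  · have h1 := congrFun hi j
    simp only [ε, decide_eq_decide] at h1
    rcases hv j i with h2 | h2
    · exact absurd rfl (h1.1 h2)
    · exact h2
  · have h1 := congrFun hi k
    simp only [ε, decide_eq_decide] at h1
    exact h1.2 hk

/-- A vector-valued quadratic form that is invariant under all reflections in a basis is
diagonal. -/
theorem diagonal_of_reflection_invariant {p : ℕ} {V Z : Type*} [AddCommGroup V] [Module ℂ V]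
    [AddCommGroup Z] [Module ℂ Z] (v : Module.Basis (Fin p) ℂ V) (c : V →ₗ[ℂ] V →ₗ[ℂ] Z)
    (h : ∀ j, ∃ D : Module.End ℂ V, (D (v j) = - v j ∧ ∀ k ≠ j, D (v k) = v k) ∧
      ∀ x, c (D x) (D x) = c x x) (x : V) :
    c x x = ∑ j, (v.repr x j) ^ 2 • c (v j) (v j) := by
  -- The reflection reverses the cross term of `v j` and `v k`. As c need not be symmetric, only the
  -- symmetrised term vanishes.
  have hanti : ∀ j k, j ≠ k → c (v j) (v k) + c (v k) (v j) = 0 := by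
    intro j k hjk
    obtain ⟨D, ⟨h1, h2⟩, h3⟩ := h j
    have h4 := h3 (v j + v k)
    rw [map_add D, h1, h2 k hjk.symm] at h4
    simp only [map_add, map_neg, LinearMap.add_apply, LinearMap.neg_apply] at h4
    have h5 : (2 : ℂ) • (c (v j) (v k) + c (v k) (v j)) = 0 := by
      rw [two_smul]
      linear_combination (norm := module) (-1 : ℂ) • h4
    exact (smul_eq_zero.1 h5).resolve_left two_ne_zero
  set y := v.repr x with hy
  have hx : x = ∑ j, y j • v j := (v.sum_repr x).symm
  have h1 : c x x = ∑ j, ∑ k, (y j * y k) • c (v j) (v k) := by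
    conv_lhs => rw [hx]
    simp [LinearMap.sum_apply, Finset.smul_sum, smul_smul]
    exact Finset.sum_comm.trans (by simp only [mul_comm])
  have h2 : (2 : ℂ) • c x x = ∑ j, ∑ k, (y j * y k) • (c (v j) (v k) + c (v k) (v j)) := by
    rw [two_smul]
    simp only [smul_add, Finset.sum_add_distrib]
    rw [← h1]
    congr 1
    rw [h1, Finset.sum_comm]
    simp only [mul_comm]
  have h3 : (2 : ℂ) • c x x = (2 : ℂ) • ∑ j, (y j) ^ 2 • c (v j) (v j) := by
    rw [h2, Finset.smul_sum]
    refine Finset.sum_congr rfl fun j _ => ?_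
    rw [Finset.sum_eq_single j, two_smul, ← smul_add, pow_two]
    · intro k _ hk
      rw [hanti j k hk.symm, smul_zero]
    · simp
  exact smul_right_injective Z (two_ne_zero (α := ℂ)) h3

/-! ### Linear deck transformations -/

section LinearDeck

variable {p : ℕ} {E : Fin p → MvPolynomial (Fin p ⊕ Fin p) ℂ} {T T' : C2 p →ₗ[ℂ] C2 p}

theorem fst_eq_of_pi1_eq {x y : C2 p} (h : pi1 E x = pi1 E y) : x.1 = y.1 :=
  (Prod.mk.injEq _ _ _ _ ▸ h : x.1 = y.1 ∧ _).1

/-- The second difference of the quadratic map E at x, x + v, x + 2v is 2 E(v). As v has no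
z'-component, this is 2 q(v), and condition B applies. -/
theorem pi1_add_eq {b : C2 p →ₗ[ℂ] C2 p →ₗ[ℂ] (Fin p → ℂ)}
    (hb : ∀ x : C2 p, evalE E x.1 x.2 = b x x) (hB : ConditionB E)
    {x v : C2 p} (h1 : pi1 E (x + v) = pi1 E x) (h2 : pi1 E (x + v + v) = pi1 E x) : v = 0 := by
  have e1 := congrArg Prod.fst h1
  have e2 : b (x + v) (x + v) = b x x := by
    rw [← hb, ← hb]; exact congrArg Prod.snd h1
  have e3 : b (x + v + v) (x + v + v) = b x x := by
    rw [← hb, ← hb]; exact congrArg Prod.snd h2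
  simp only [pi1, Prod.fst_add, add_eq_left] at e1
  simp only [map_add, LinearMap.add_apply] at e2 e3
  have h5 : (2 : ℂ) • b v v = 0 := by
    rw [two_smul]
    linear_combination (norm := module) e3 - (2 : ℂ) • e2
  have h6 : b v v = 0 := (smul_eq_zero.1 h5).resolve_left two_ne_zero
  rw [← hb, e1] at h6
  exact Prod.ext e1 (hB _ h6)

/-- With R = T² - 1, R²x = 0 gives T²x = x + Rx and T⁴x = x + 2Rx, three points with the same image,
so Rx = 0. If R were non-zero, T would have an eigenvector in the range of R, which lies in the
fibre; homogeneity of q forces its eigenvalue to be ±1, so R kills it, contradicting ker R² = ker R.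
-/
theorem linear_deck_involutive (hE : ∀ j, (E j).IsHomogeneous 2) (hB : ConditionB E)
    (hT : ∀ x, pi1 E (T x) = pi1 E x) : T * T = (1 : Module.End ℂ (C2 p)) := by
  obtain ⟨b, hb⟩ := exists_bilinear_evalE hE
  set R : Module.End ℂ (C2 p) := T * T - 1 with hR
  have hfst : ∀ x, (T x).1 = x.1 := fun x => fst_eq_of_pi1_eq (hT x)
  have hfix : ∀ x, R (R x) = 0 → R x = 0 := by
    intro x hx
    have e1 : T (T x) = x + R x := by simp [hR]
    have e2 : T (T (R x)) = R x := by
      have : R (R x) = T (T (R x)) - R x := by simp [hR]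
      rw [this] at hx
      exact sub_eq_zero.1 hx
    refine pi1_add_eq hb hB (x := x) ?_ ?_
    · rw [← e1, hT, hT]
    · have : x + R x + R x = T (T (T (T x))) := by
        rw [e1, map_add, map_add, e2, e1]
      rw [this, hT, hT, hT, hT]
  by_contra hne
  have hR0 : R ≠ 0 := fun h => hne (sub_eq_zero.1 h)
  have hcom : ∀ x, T (R x) = R (T x) := by intro x; simp [hR]
  have hmap : ∀ x ∈ LinearMap.range R, T x ∈ LinearMap.range R := by
    rintro _ ⟨x, rfl⟩
    exact ⟨T x, (hcom x).symm⟩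
  have : Nontrivial (LinearMap.range R) := by
    rw [Submodule.nontrivial_iff_ne_bot]
    exact fun h => hR0 (LinearMap.range_eq_bot.1 h)
  obtain ⟨μ, hμ⟩ := Module.End.exists_eigenvalue (LinearMap.restrict T hmap)
  obtain ⟨⟨v, x, hx⟩, hv, hv0⟩ := hμ.exists_hasEigenvector
  have hv' : T v = μ • v := by
    have := Module.End.mem_eigenspace_iff.1 hv
    simpa using congrArg Subtype.val this
  have hv0' : v ≠ 0 := fun h => hv0 (Subtype.ext h)
  have hv1 : v.1 = 0 := by
    rw [← hx]
    simp [hR, hfst]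
  have hq : evalE E 0 v.2 ≠ 0 := fun h => hv0' (Prod.ext hv1 (hB _ h))
  have hμ2 : μ ^ 2 = 1 := by
    have := congrArg Prod.snd (hT v)
    simp only [pi1, hv', Prod.smul_fst, Prod.smul_snd, evalE_smul hE, hv1] at this
    have h2 : (μ ^ 2 - 1) • evalE E 0 v.2 = 0 := by rw [sub_smul, this, one_smul, sub_self]
    exact sub_eq_zero.1 ((smul_eq_zero.1 h2).resolve_right hq)
  have hRv : R v = 0 := by
    change T (T v) - v = 0
    rw [hv', map_smul, hv', smul_smul, ← pow_two, hμ2, one_smul, sub_self]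
  rw [← hx] at hRv
  exact hv0' (hx ▸ hfix x hRv)

/-- A linear deck transformation is determined by its restriction to `{0} × ℂ^p`. -/
theorem linear_deck_ext (hE : ∀ j, (E j).IsHomogeneous 2) (hB : ConditionB E)
    (hT : ∀ x, pi1 E (T x) = pi1 E x) (hT' : ∀ x, pi1 E (T' x) = pi1 E x)
    (h : ∀ w, T (0, w) = T' (0, w)) : T = T' := by
  have hTT := linear_deck_involutive hE hB hT
  have hTT' := linear_deck_involutive hE hB hT'
  have hR : ∀ x, pi1 E ((T' * T : Module.End ℂ (C2 p)) x) = pi1 E x := by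
    intro x; rw [Module.End.mul_apply, hT', hT]
  have hRR := linear_deck_involutive hE hB hR
  have hfst : ∀ x, (T x).1 = x.1 := fun x => fst_eq_of_pi1_eq (hT x)
  have hfst' : ∀ x, (T' x).1 = x.1 := fun x => fst_eq_of_pi1_eq (hT' x)
  have h1 : (T' * T : Module.End ℂ (C2 p)) = 1 := by
    refine LinearMap.ext fun x => ?_
    -- The displacement v lies in the fibre, where T'T is the identity; hence (T'T)² x = x + 2v, and
    -- involutivity of T'T gives v = 0.
    set v := T' (T x) - x with hv
    have hv1 : v.1 = 0 := by simp [hv, hfst, hfst']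
    have hv2 : v = (0, v.2) := Prod.ext hv1 rfl
    have e1 : T' (T x) = x + v := by simp [hv]
    have e2 : T' (T v) = v := by
      have h0 : (T v).1 = 0 := by rw [hfst, hv1]
      have : T v = T' v := by rw [hv2]; exact h _
      rw [this]
      exact LinearMap.congr_fun hTT' v
    have e3 : T' (T (T' (T x))) = x := LinearMap.congr_fun hRR x
    rw [e1, map_add, map_add, e1, e2, add_assoc, add_eq_left, ← two_smul ℂ] at e3
    have := (smul_eq_zero.1 e3).resolve_left two_ne_zero
    rw [Module.End.mul_apply, e1, this, add_zero, Module.End.one_apply]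
  calc T = (T' * T') * T := by rw [hTT', one_mul]
    _ = T' := by rw [mul_assoc, h1, mul_one]

/-- The action of a linear map of `ℂ^p × ℂ^p` on the second factor. -/
def fibrePart (T : C2 p →ₗ[ℂ] C2 p) : Module.End ℂ (Fin p → ℂ) :=
  (LinearMap.snd ℂ _ _).comp (T.comp (LinearMap.inr ℂ _ _))

theorem linear_deck_apply (hT : ∀ x, pi1 E (T x) = pi1 E x) (w : Fin p → ℂ) :
    T (0, w) = (0, fibrePart T w) :=
  Prod.ext ((fst_eq_of_pi1_eq (hT (0, w))).trans rfl) rfl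

theorem fibrePart_mul (hT : ∀ x, pi1 E (T x) = pi1 E x) (hT' : ∀ x, pi1 E (T' x) = pi1 E x) :
    fibrePart (T * T' : Module.End ℂ (C2 p)) = fibrePart T * fibrePart T' := by
  refine LinearMap.ext fun w => ?_
  change (T (T' (0, w))).2 = _
  rw [linear_deck_apply hT', linear_deck_apply hT]
  rfl

/-- Under conditions B and D there are coordinates in the fibre in which `q` is diagonal. -/
theorem exists_basis_diagonal (hE : ∀ j, (E j).IsHomogeneous 2) (hB : ConditionB E)
    (hD : ConditionD E) :
    ∃ v : Module.Basis (Fin p) ℂ (Fin p → ℂ),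
      ∀ w, evalE E 0 w = ∑ j, (v.repr w j) ^ 2 • evalE E 0 (v j) := by
  have hfin : (deckGerms E).Finite := Set.finite_of_ncard_ne_zero (by rw [hD]; positivity)
  have : Fintype (deckGerms E) := hfin.fintype
  have hcard : Fintype.card (deckGerms E) = 2 ^ p := by
    rw [← hD, Set.ncard_eq_toFinset_card', Set.toFinset_card]
  choose τ hτ hτg using fun g : deckGerms E => g.2
  let T : deckGerms E → (C2 p →ₗ[ℂ] C2 p) := fun g => (fderiv ℂ (τ g) 0 : C2 p →ₗ[ℂ] C2 p)
  have hT : ∀ g x, pi1 E (T g x) = pi1 E x := fun g x => (hτ g).linear_part hE x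
  have hTT : ∀ g, T g * T g = (1 : Module.End ℂ (C2 p)) := fun g =>
    linear_deck_involutive hE hB (hT g)
  have hTinj : Function.Injective T := by
    intro g g' hgg
    have hdeck : IsDeck E (fderiv ℂ (τ g) 0) := by
      refine ⟨IsBiholGerm.linear (hτ g).1.2.2, Eventually.of_forall fun x => hT g x⟩
    -- Composed with the linear part of `τ g`, which is its own inverse, a deck map with the same
    -- linear part becomes tangent to the identity, hence the identity germ. So a deck germ is
    -- determined by its linear part.
    have hder : ∀ g'', T g'' = T g → fderiv ℂ (fderiv ℂ (τ g) 0 ∘ τ g'') 0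
        = ContinuousLinearMap.id ℂ _ := by
      intro g'' h
      rw [(hdeck.1.comp (hτ g'').1).2, (fderiv ℂ (τ g) 0).hasFDerivAt.fderiv]
      refine ContinuousLinearMap.ext fun x => ?_
      change T g (T g'' x) = x
      rw [h]
      exact LinearMap.congr_fun (hTT g) x
    have h1 := (hdeck.comp (hτ g)).eventually_eq_id hfin (hder g rfl)
    have h2 := (hdeck.comp (hτ g')).eventually_eq_id hfin (hder g' hgg.symm)
    refine Subtype.ext ?_
    rw [← hτg g, ← hτg g', Germ.coe_eq]
    filter_upwards [h1, h2] with x h3 h4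
    exact (hτ g).1.2.2.1 (h3.trans h4.symm)
  have hTm : ∀ g g' x, pi1 E ((T g * T g' : Module.End ℂ (C2 p)) x) = pi1 E x := by
    intro g g' x
    rw [Module.End.mul_apply, hT, hT]
  have hone : fibrePart (1 : Module.End ℂ (C2 p)) = 1 := rfl
  have hDD : ∀ g, fibrePart (T g) * fibrePart (T g) = 1 := by
    intro g
    rw [← fibrePart_mul (hT g) (hT g), hTT, hone]
  obtain ⟨v, hv⟩ := exists_basis_of_commuting_involutions (p := p) (V := Fin p → ℂ) (by simp) hcard
    (fun g => fibrePart (T g)) (by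
      intro g g' h
      refine hTinj (linear_deck_ext hE hB (hT g) (hT g') fun w => ?_)
      rw [linear_deck_apply (hT g), linear_deck_apply (hT g')]
      exact congrArg _ (LinearMap.congr_fun h w)) hDD (by
      -- For involutions a, b whose product is also an involution, (ab)² = 1 gives ab = ba.
      intro g g'
      have h1 := linear_deck_involutive hE hB (hTm g g')
      have h2 : fibrePart (T g) * fibrePart (T g') * (fibrePart (T g) * fibrePart (T g')) = 1 := by
        rw [← fibrePart_mul (hT g) (hT g'), ← fibrePart_mul (hTm g g') (hTm g g'), h1, hone]
      calc fibrePart (T g) * fibrePart (T g')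
          = fibrePart (T g) * fibrePart (T g') * ((fibrePart (T g) * (fibrePart (T g') *
            fibrePart (T g')) * fibrePart (T g))) := by rw [hDD, mul_one, hDD, mul_one]
        _ = fibrePart (T g) * fibrePart (T g') * (fibrePart (T g) * fibrePart (T g')) *
            (fibrePart (T g') * fibrePart (T g)) := by simp only [mul_assoc]
        _ = fibrePart (T g') * fibrePart (T g) := by rw [h2, one_mul])
  obtain ⟨b, hb⟩ := exists_bilinear_evalE hE
  have hq : ∀ w, evalE E 0 w =
      (b.compl₁₂ (LinearMap.inr ℂ _ _) (LinearMap.inr ℂ _ _)) w w := fun w => hb (0, w)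
  refine ⟨v, fun w => ?_⟩
  simp only [hq]
  refine diagonal_of_reflection_invariant v _ (fun j => ?_) w
  obtain ⟨g, hg⟩ := hv j
  refine ⟨fibrePart (T g), hg, fun x => ?_⟩
  rw [← hq, ← hq]
  have := congrArg Prod.snd (hT g (0, x))
  rwa [linear_deck_apply (hT g)] at this

end LinearDeck

/-! ### Reduction of M to a system of squares -/

/-- The squares of the components of `A₁ x + A₂ (conj x)`. -/
def sqForm {p : ℕ} (A₁ A₂ : Matrix (Fin p) (Fin p) ℂ) (x : Fin p → ℂ) : Fin p → ℂ :=
  fun j => ((A₁ *ᵥ x + A₂ *ᵥ star x) j) ^ 2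

section

variable {p : ℕ} {E : Fin p → MvPolynomial (Fin p ⊕ Fin p) ℂ} {T : C2 p →ₗ[ℂ] C2 p}

/-- The range of T - 1 lies in {0} × ℂ^p and has dimension 2p - p, so it is the whole fibre; an
involution acts by -1 on that range. -/
theorem linear_deck_neg (hE : ∀ j, (E j).IsHomogeneous 2) (hB : ConditionB E)
    (hT : ∀ x, pi1 E (T x) = pi1 E x)
    (hdim : Module.finrank ℂ (LinearMap.ker (T - LinearMap.id)) = p) (w : Fin p → ℂ) :
    T (0, w) = (0, -w) := by
  have hTT := linear_deck_involutive hE hB hT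
  set R : C2 p →ₗ[ℂ] C2 p := T - LinearMap.id with hR
  have hle : LinearMap.range R ≤ LinearMap.range (LinearMap.inr ℂ (Fin p → ℂ) (Fin p → ℂ)) := by
    rintro _ ⟨x, rfl⟩
    refine ⟨(R x).2, Prod.ext ?_ rfl⟩
    simp [hR, fst_eq_of_pi1_eq (hT x)]
  have hrank := LinearMap.finrank_range_add_finrank_ker R
  rw [hdim, Module.finrank_prod, Module.finrank_fin_fun] at hrank
  have heq := Submodule.eq_of_le_of_finrank_eq hle (by
    rw [LinearMap.finrank_range_of_inj LinearMap.inr_injective, Module.finrank_fin_fun]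
    omega)
  have hmem : ((0, w) : C2 p) ∈ LinearMap.range R := by
    rw [heq]; exact ⟨w, rfl⟩
  obtain ⟨x, hx⟩ := hmem
  have h1 : T (T x) = x := LinearMap.congr_fun hTT x
  have h2 : ((0, -w) : C2 p) = - (0, w) := by simp
  rw [h2, ← hx]
  simp [hR, h1]

/-- T(z, w) = (z, Az - w), so E(z, w) = E(z, Az/2) + q(w - Az/2). At w = z̄ the first term is a
holomorphic quadratic form and the second is diagonal in a basis of the fibre. The formula for T
recorded here is what links condition E to A₁ and A₂. -/
theorem QuadEquiv.exists_sqForm (hE : ∀ j, (E j).IsHomogeneous 2) (hB : ConditionB E)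
    (hD : ConditionD E) (hT : IsMoserWebster E T) :
    ∃ A₁ A₂ : Matrix (Fin p) (Fin p) ℂ, IsUnit A₂ ∧
      QuadEquiv (sqForm A₁ A₂) (fun x => evalE E x (star x)) ∧ (∀ x, (T x).1 = x.1) ∧
      ∀ x, A₂ *ᵥ (T x).2 = -(A₂ *ᵥ x.2) - (2 : ℂ) • A₁ *ᵥ x.1 := by
  obtain ⟨τ, hτ, rfl, hdim⟩ := hT
  set T : C2 p →ₗ[ℂ] C2 p := (fderiv ℂ τ 0 : C2 p →ₗ[ℂ] C2 p) with hTdef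
  have hT : ∀ x, pi1 E (T x) = pi1 E x := fun x => hτ.linear_part hE x
  have hneg := linear_deck_neg hE hB hT hdim
  obtain ⟨v, hv⟩ := exists_basis_diagonal hE hB hD
  obtain ⟨b, hb⟩ := exists_bilinear_evalE hE
  let A : (Fin p → ℂ) →ₗ[ℂ] (Fin p → ℂ) :=
    (LinearMap.snd ℂ _ _).comp (T.comp (LinearMap.inl ℂ _ _))
  have hTA : ∀ z w, T (z, w) = (z, A z - w) := by
    intro z w
    have h1 : ((z, w) : C2 p) = (z, 0) + (0, w) := by simp
    rw [h1, map_add, hneg]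
    refine Prod.ext ?_ ?_
    · have := fst_eq_of_pi1_eq (hT (z, 0))
      simp [this]
    · simp [A, sub_eq_add_neg]
  -- the quadratic form is even in the fibre variable measured from the midpoint
  have hsplit : ∀ z u, evalE E z (u + (2⁻¹ : ℂ) • A z) =
      evalE E z ((2⁻¹ : ℂ) • A z) + evalE E 0 u := by
    intro z u
    have e1 : ∀ u, evalE E z (u + (2⁻¹ : ℂ) • A z) =
        b ((z, (2⁻¹ : ℂ) • A z) + (0, u)) ((z, (2⁻¹ : ℂ) • A z) + (0, u)) := by
      intro u
      rw [← hb]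
      simp [add_comm]
    have e2 : evalE E z ((2⁻¹ : ℂ) • A z) = b (z, (2⁻¹ : ℂ) • A z) (z, (2⁻¹ : ℂ) • A z) := by
      rw [← hb]
    have e3 : evalE E 0 u = b (0, u) (0, u) := by rw [← hb]
    have e4 : evalE E z (-u + (2⁻¹ : ℂ) • A z) = evalE E z (u + (2⁻¹ : ℂ) • A z) := by
      have h1 := congrArg Prod.snd (hT (z, u + (2⁻¹ : ℂ) • A z))
      rw [hTA] at h1
      have h2 : A z - (u + (2⁻¹ : ℂ) • A z) = -u + (2⁻¹ : ℂ) • A z := by module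
      rw [h2] at h1
      exact h1
    have e5 : ((0, -u) : C2 p) = -(0, u) := by simp
    rw [e1, e1, e5] at e4
    rw [e1, e2, e3]
    simp only [map_add, map_neg, LinearMap.add_apply, LinearMap.neg_apply] at e4 ⊢
    linear_combination (norm := module) (-2⁻¹ : ℂ) • e4
  -- A linear relation with coefficients c j becomes a zero of q at the vector with coordinates √(c
  -- j), which condition B excludes.
  have hLI : LinearIndependent ℂ (fun j => evalE E 0 (v j)) := by
    rw [Fintype.linearIndependent_iff]
    intro c hc i
    choose y hy using fun j => IsAlgClosed.exists_pow_nat_eq (c j) (n := 2) two_pos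
    have h1 := hv (v.equivFun.symm y)
    have h2 : ∀ j, v.repr (v.equivFun.symm y) j = y j := fun j => by
      rw [← Module.Basis.equivFun_apply, LinearEquiv.apply_symm_apply]
    simp only [h2, hy, hc] at h1
    have h3 : y = 0 := v.equivFun.symm.map_eq_zero_iff.1 (hB _ h1)
    rw [← hy, h3]
    simp
  let q : Module.Basis (Fin p) ℂ (Fin p → ℂ) :=
    basisOfLinearIndependentOfCardEqFinrank' _ hLI (by simp)
  have hq : ∀ j, q j = evalE E 0 (v j) := fun j => by simp [q]
  let A₂ : Matrix (Fin p) (Fin p) ℂ := LinearMap.toMatrix' v.equivFun.toLinearMap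
  have hA₂ : ∀ w, A₂ *ᵥ w = v.equivFun w := fun w => by
    rw [LinearMap.toMatrix'_mulVec]; rfl
  let A₁ : Matrix (Fin p) (Fin p) ℂ :=
    LinearMap.toMatrix' (-(2⁻¹ : ℂ) • (v.equivFun.toLinearMap.comp A))
  have hA₁ : ∀ z, A₁ *ᵥ z = -(2⁻¹ : ℂ) • v.equivFun (A z) := fun w => by
    rw [LinearMap.toMatrix'_mulVec]; rfl
  refine ⟨A₁, A₂, ?_, ⟨LinearEquiv.refl ℂ _, q.equivFun.symm,
    b.compl₁₂ (LinearMap.prod LinearMap.id ((2⁻¹ : ℂ) • A))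
      (LinearMap.prod LinearMap.id ((2⁻¹ : ℂ) • A)), fun x => ?_⟩, fun x => ?_, fun x => ?_⟩
  · rw [← Matrix.mulVec_injective_iff_isUnit]
    intro w w' h
    simp only [hA₂] at h
    exact v.equivFun.injective h
  · have h1 := hsplit x (star x - (2⁻¹ : ℂ) • A x)
    rw [sub_add_cancel] at h1
    have h2 : evalE E x ((2⁻¹ : ℂ) • A x) =
        b (x, (2⁻¹ : ℂ) • A x) (x, (2⁻¹ : ℂ) • A x) := by rw [← hb]
    change evalE E x (star x) = _
    rw [h1, h2, add_comm, hv, Module.Basis.equivFun_symm_apply]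
    congr 1
    refine Finset.sum_congr rfl fun j _ => ?_
    rw [hq, sqForm, hA₁, hA₂]
    congr 2
    simp [sub_eq_add_neg, add_comm]
  · exact fst_eq_of_pi1_eq (hT x)
  · obtain ⟨z, w⟩ := x
    rw [hTA, hA₂, hA₂, hA₁, map_sub]
    module

end

/-! ### The diagonal entries δ of γγ̄ and the type of an index -/

namespace BishopInvariants

variable {p : ℕ} (Γ : BishopInvariants p)

theorem prt_of_lt {i : Fin p} (hi : (i : ℕ) < Γ.e + Γ.h) : Γ.prt i = i := by
  simp [prt, partner, hi]

theorem coe_prt_of_lt {i : Fin p} (hi : Γ.e + Γ.h ≤ (i : ℕ))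
    (hi' : (i : ℕ) < Γ.e + Γ.h + Γ.s) : (Γ.prt i : ℕ) = i + Γ.s := by
  simp [prt, partner, hi', not_lt.2 hi]

theorem coe_prt_of_le {i : Fin p} (hi : Γ.e + Γ.h + Γ.s ≤ (i : ℕ)) :
    (Γ.prt i : ℕ) = i - Γ.s := by
  have : ¬ (i : ℕ) < Γ.e + Γ.h := by omega
  simp [prt, partner, this, not_lt.2 hi]

theorem prt_prt (i : Fin p) : Γ.prt (Γ.prt i) = i := by
  have := Γ.sum_eq
  rcases lt_or_ge (i : ℕ) (Γ.e + Γ.h) with h1 | h1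
  · rw [Γ.prt_of_lt (i := i) h1, Γ.prt_of_lt h1]
  · rcases lt_or_ge (i : ℕ) (Γ.e + Γ.h + Γ.s) with h2 | h2
    · have h3 := Γ.coe_prt_of_lt h1 h2
      ext
      rw [Γ.coe_prt_of_le (by omega), h3]
      omega
    · have h3 := Γ.coe_prt_of_le h2
      ext
      rw [Γ.coe_prt_of_lt (by omega) (by omega), h3]
      omega

theorem block_cases (i : Fin p) : (i : ℕ) < Γ.e ∨ (Γ.e ≤ (i : ℕ) ∧ (i : ℕ) < Γ.e + Γ.h) ∨
    (Γ.e + Γ.h ≤ (i : ℕ) ∧ (i : ℕ) < Γ.e + Γ.h + Γ.s) ∨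
    ∃ j : Fin p, (Γ.e + Γ.h ≤ (j : ℕ) ∧ (j : ℕ) < Γ.e + Γ.h + Γ.s) ∧ i = Γ.prt j := by
  have := Γ.sum_eq
  have := i.2
  rcases lt_or_ge (i : ℕ) (Γ.e + Γ.h + Γ.s) with h1 | h1
  · omega
  · refine Or.inr (Or.inr (Or.inr ⟨Γ.prt i, ?_, (Γ.prt_prt i).symm⟩))
    rw [Γ.coe_prt_of_le h1]
    omega

/-- The diagonal entries of `γ (conj γ)`. -/
noncomputable def delta (i : Fin p) : ℂ := Γ.γ i * conj (Γ.γ (Γ.prt i))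

theorem delta_prt (i : Fin p) : Γ.delta (Γ.prt i) = conj (Γ.delta i) := by
  simp [delta, Γ.prt_prt, mul_comm]

theorem delta_elliptic {i : Fin p} (hi : (i : ℕ) < Γ.e) :
    ∃ r : ℝ, 0 < r ∧ r < 1 / 2 ∧ Γ.γ i = r ∧ Γ.delta i = (r ^ 2 : ℝ) := by
  obtain ⟨r, h0, h1, hr⟩ := Γ.elliptic i hi
  refine ⟨r, h0, h1, hr, ?_⟩
  rw [delta, Γ.prt_of_lt (by omega), hr]
  simp [pow_two]

theorem delta_hyperbolic {i : Fin p} (hi : Γ.e ≤ (i : ℕ)) (hi' : (i : ℕ) < Γ.e + Γ.h) :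
    ∃ r : ℝ, 1 / 2 < r ∧ Γ.γ i = r ∧ Γ.delta i = (r ^ 2 : ℝ) := by
  obtain ⟨r, h1, hr⟩ := Γ.hyperbolic i hi hi'
  refine ⟨r, h1, hr, ?_⟩
  rw [delta, Γ.prt_of_lt hi', hr]
  simp [pow_two]

theorem delta_complex {i : Fin p} (hi : Γ.e + Γ.h ≤ (i : ℕ)) (hi' : (i : ℕ) < Γ.e + Γ.h + Γ.s) :
    Γ.delta i = Γ.γ i * (1 - Γ.γ i) ∧ 0 < (Γ.delta i).im := by
  have h1 : Γ.delta i = Γ.γ i * (1 - Γ.γ i) := by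
    rw [delta, prt, Γ.complex_partner i hi hi']
    simp
  refine ⟨h1, ?_⟩
  obtain ⟨h2, h3⟩ := Γ.complex i hi hi'
  rw [h1]
  simp only [Complex.mul_im, Complex.sub_re, Complex.sub_im, Complex.one_re, Complex.one_im]
  -- Im γ(1 - γ) = Im γ · (1 - 2 Re γ).
  nlinarith

/-- The four kinds of index have δ in disjoint regions: real below 1/4, real above 1/4, the upper
half-plane, and, for partners, the lower half-plane. Hence δ alone reveals the type. -/
theorem lt_e_iff (i : Fin p) :
    (i : ℕ) < Γ.e ↔ (Γ.delta i).im = 0 ∧ (Γ.delta i).re < 1 / 4 := by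
  rcases Γ.block_cases i with h | h | h | ⟨j, h, rfl⟩
  · obtain ⟨r, h0, h1, -, hr⟩ := Γ.delta_elliptic h
    simp only [h, hr, Complex.ofReal_im, Complex.ofReal_re, true_iff, true_and]
    nlinarith
  · obtain ⟨r, h1, -, hr⟩ := Γ.delta_hyperbolic h.1 h.2
    simp only [not_lt.2 h.1, hr, Complex.ofReal_im, Complex.ofReal_re, true_and, false_iff, not_lt]
    nlinarith
  · have h1 := (Γ.delta_complex h.1 h.2).2
    have h2 : ¬ (i : ℕ) < Γ.e := by omega
    simp [h2, h1.ne']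
  · have h1 := (Γ.delta_complex h.1 h.2).2
    have h2 : ¬ (Γ.prt j : ℕ) < Γ.e := by rw [Γ.coe_prt_of_lt h.1 h.2]; omega
    simp [h2, Γ.delta_prt, h1.ne']

theorem mem_hyperbolic_iff (i : Fin p) : (Γ.e ≤ (i : ℕ) ∧ (i : ℕ) < Γ.e + Γ.h) ↔
    (Γ.delta i).im = 0 ∧ 1 / 4 < (Γ.delta i).re := by
  rcases Γ.block_cases i with h | h | h | ⟨j, h, rfl⟩
  · obtain ⟨r, h0, h1, -, hr⟩ := Γ.delta_elliptic h
    simp only [not_le.2 h, hr, Complex.ofReal_im, Complex.ofReal_re, true_and, false_and,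
      false_iff, not_lt]
    nlinarith
  · obtain ⟨r, h1, -, hr⟩ := Γ.delta_hyperbolic h.1 h.2
    simp only [h, hr, Complex.ofReal_im, Complex.ofReal_re, true_and, and_true, true_iff]
    nlinarith
  · have h1 := (Γ.delta_complex h.1 h.2).2
    have h2 : ¬ (Γ.e ≤ (i : ℕ) ∧ (i : ℕ) < Γ.e + Γ.h) := by omega
    simp [h2, h1.ne']
  · have h1 := (Γ.delta_complex h.1 h.2).2
    have h2 : ¬ (Γ.e ≤ (Γ.prt j : ℕ) ∧ (Γ.prt j : ℕ) < Γ.e + Γ.h) := by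
      rw [Γ.coe_prt_of_lt h.1 h.2]; omega
    simp [h2, Γ.delta_prt, h1.ne']

theorem mem_complex_iff (i : Fin p) : (Γ.e + Γ.h ≤ (i : ℕ) ∧ (i : ℕ) < Γ.e + Γ.h + Γ.s) ↔
    0 < (Γ.delta i).im := by
  rcases Γ.block_cases i with h | h | h | ⟨j, h, rfl⟩
  · obtain ⟨r, h0, h1, -, hr⟩ := Γ.delta_elliptic h
    have h2 : ¬ (Γ.e + Γ.h ≤ (i : ℕ) ∧ (i : ℕ) < Γ.e + Γ.h + Γ.s) := by omega
    simp only [h2, hr, Complex.ofReal_im, lt_irrefl]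
  · obtain ⟨r, h1, -, hr⟩ := Γ.delta_hyperbolic h.1 h.2
    have h2 : ¬ (Γ.e + Γ.h ≤ (i : ℕ) ∧ (i : ℕ) < Γ.e + Γ.h + Γ.s) := by omega
    simp only [h2, hr, Complex.ofReal_im, lt_irrefl]
  · simp [h, (Γ.delta_complex h.1 h.2).2]
  · have h1 := (Γ.delta_complex h.1 h.2).2
    have h2 : ¬ (Γ.e + Γ.h ≤ (Γ.prt j : ℕ) ∧ (Γ.prt j : ℕ) < Γ.e + Γ.h + Γ.s) := by
      rw [Γ.coe_prt_of_lt h.1 h.2]; omega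
    simp only [h2, Γ.delta_prt, Complex.conj_im, false_iff, not_lt]
    linarith

theorem delta_ne_zero (i : Fin p) : Γ.delta i ≠ 0 := by
  rcases Γ.block_cases i with h | h | h | ⟨j, h, rfl⟩
  · obtain ⟨r, h0, h1, -, hr⟩ := Γ.delta_elliptic h
    rw [hr]
    exact_mod_cast (by positivity : r ^ 2 ≠ 0)
  · obtain ⟨r, h1, -, hr⟩ := Γ.delta_hyperbolic h.1 h.2
    have : 0 < r := by linarith
    rw [hr]
    exact_mod_cast (by positivity : r ^ 2 ≠ 0)
  · intro h0
    have := (Γ.delta_complex h.1 h.2).2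
    simp [h0] at this
  · intro h0
    have := (Γ.delta_complex h.1 h.2).2
    rw [Γ.delta_prt, map_eq_zero] at h0
    simp [h0] at this

theorem gamma_ne_zero (i : Fin p) : Γ.γ i ≠ 0 := left_ne_zero_of_mul (Γ.delta_ne_zero i)

theorem mat_apply (i j : Fin p) : Γ.mat i j = if j = Γ.prt i then Γ.γ i else 0 := rfl

theorem eq_prt_comm {i j : Fin p} : j = Γ.prt i ↔ i = Γ.prt j :=
  ⟨fun h => by rw [h, Γ.prt_prt], fun h => by rw [h, Γ.prt_prt]⟩

/-- A consimilarity Γ' = PΓP̄⁻¹ induces the similarity Γ'Γ̄' = PΓΓ̄P⁻¹, so these diagonal entries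
are what equivalences preserve. -/
theorem mat_mul_map_star : Γ.mat * Γ.mat.map star = Matrix.diagonal Γ.delta := by
  ext i j
  rw [Matrix.mul_apply, Finset.sum_eq_single (Γ.prt i)]
  · simp only [mat_apply, Matrix.map_apply, Γ.prt_prt, if_true, Matrix.diagonal_apply, delta]
    by_cases h : j = i
    · simp [h]
    · simp [h, Ne.symm h]
  · intro k _ hk
    simp [mat_apply, hk]
  · simp

end BishopInvariants

/-! ### Ordered enumerations, complexification and monomial matrices -/

/-- A finite set can be listed so that an injective key increases. -/
theorem Finset.exists_strictMono_enum {α β : Type*} [Nonempty α] [LinearOrder β] (S : Finset α)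
    (key : α → β) (hkey : Set.InjOn key S) :
    ∃ f : ℕ → α, (∀ i < S.card, f i ∈ S) ∧
      ∀ i j, i < j → j < S.card → key (f i) < key (f j) := by
  classical
  have hcard : (S.image key).card = S.card := Finset.card_image_of_injOn hkey
  let o := (S.image key).orderEmbOfFin hcard
  have ho : ∀ i, ∃ a ∈ S, key a = o i := fun i =>
    Finset.mem_image.1 ((S.image key).orderEmbOfFin_mem hcard i)
  choose g hg hgo using ho
  refine ⟨fun i => if h : i < S.card then g ⟨i, h⟩ else Classical.arbitrary α,
    fun i hi => by simp [hi, hg], fun i j hij hj => ?_⟩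
  have hi := hij.trans hj
  simp only [hi, hj, dif_pos, hgo]
  exact o.strictMono hij

/-- Strictly increasing enumerations of the same finite set agree. -/
theorem eqOn_of_strictMonoOn_key {ι α β : Type*} [LinearOrder ι] [LinearOrder β] (I : Finset ι)
    {f g : ι → α} (key : α → β) (hf : StrictMonoOn (key ∘ f) I) (hg : StrictMonoOn (key ∘ g) I)
    (him : f '' I = g '' I) : Set.EqOn f g I := by
  classical
  have hfg : I.image (key ∘ f) = I.image (key ∘ g) := by
    rw [← Finset.coe_inj, Finset.coe_image, Finset.coe_image, Set.image_comp, him, Set.image_comp]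
  -- The rank of `key (f i)` among the keys is the rank of i in I, so a common value occurs at the
  -- same index for f and g.
  have hrank : ∀ {f : ι → α}, StrictMonoOn (key ∘ f) I → ∀ i ∈ I,
      ((I.image (key ∘ f)).filter (· < key (f i))).card = (I.filter (· < i)).card := by
    intro f hf i hi
    rw [Finset.filter_image, Finset.card_image_of_injOn]
    · congr 1
      refine Finset.filter_congr fun j hj => ?_
      exact hf.lt_iff_lt hj hi
    · exact hf.injOn.mono fun x hx => (Finset.mem_filter.1 hx).1
  have hinj : ∀ i ∈ I, ∀ k ∈ I, (I.filter (· < i)).card = (I.filter (· < k)).card → ¬ i < k := by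
    intro i hi k hk h hik
    refine h.not_lt (Finset.card_lt_card ?_)
    rw [Finset.ssubset_iff_of_subset]
    · exact ⟨i, by simp [hi, hik], by simp⟩
    · intro j hj
      simp only [Finset.mem_filter] at hj ⊢
      exact ⟨hj.1, hj.2.trans hik⟩
  intro i hi
  obtain ⟨k, hk, hki⟩ : f i ∈ g '' I := him ▸ Set.mem_image_of_mem f hi
  have h1 := hrank hf i hi
  have h2 := hrank hg k hk
  rw [hfg, ← hki, h2] at h1
  have : i = k := le_antisymm (not_lt.1 (hinj k hk i hi h1)) (not_lt.1 (hinj i hi k hk h1.symm))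
  rw [this] at hki ⊢
  exact hki.symm

/-- A complex bilinear form that vanishes on the diagonal of the totally real subspace
`w = conj z` vanishes on the whole diagonal. -/
theorem bilinear_diag_eq_zero {p : ℕ} {Z : Type*} [AddCommGroup Z] [Module ℂ Z]
    (g : C2 p →ₗ[ℂ] C2 p →ₗ[ℂ] Z) (hg : ∀ x : Fin p → ℂ, g (x, star x) (x, star x) = 0)
    (v : C2 p) : g v v = 0 := by
  obtain ⟨z, w⟩ := v
  set r : Fin p → ℂ := (2⁻¹ : ℂ) • (z + star w) with hr
  set r' : Fin p → ℂ := -((2⁻¹ : ℂ) * Complex.I) • (z - star w) with hr'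
  -- The vectors (r, r̄) form a real form of ℂ^p × ℂ^p; r and r' give the real and imaginary parts
  -- of (z, w) with respect to it.
  have hv : ((z, w) : C2 p) = (r, star r) + Complex.I • (r', star r') := by
    refine Prod.ext ?_ ?_
    · ext i
      simp only [hr, hr', Prod.fst_add, Prod.smul_fst, Pi.add_apply, Pi.smul_apply, Pi.sub_apply,
        smul_eq_mul]
      linear_combination ((z i - star w i) / 2) * Complex.I_mul_I
    · ext i
      simp only [hr, hr', Prod.snd_add, Prod.smul_snd, Pi.add_apply, Pi.smul_apply, Pi.sub_apply,
        smul_eq_mul, Pi.star_apply, star_mul', star_add, star_sub, star_neg, star_inv₀, star_ofNat,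
        Complex.star_def, Complex.conj_I, Complex.conj_conj]
      linear_combination ((w i - conj (z i)) / 2) * Complex.I_mul_I
  have h1 := hg r
  have h2 := hg r'
  have h3 := hg (r + r')
  have h4 : ((r + r', star (r + r')) : C2 p) = (r, star r) + (r', star r') := by simp
  rw [h4] at h3
  rw [hv]
  simp only [map_add, map_smul, LinearMap.add_apply, LinearMap.smul_apply, h1, h2, zero_add,
    add_zero, smul_zero] at h3 ⊢
  linear_combination (norm := module) Complex.I • h3

theorem diagPerm_mulVec {p : ℕ} (ν : Equiv.Perm (Fin p)) (d y : Fin p → ℂ) (i : Fin p) :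
    (diagPerm ν d *ᵥ y) i = d i * y (ν i) := by
  simp [diagPerm, Matrix.mulVec, dotProduct]

/-- If the squares of the components of `C y` are linear in the squares of the components of `y`,
then the non-singular matrix `C` is monomial. -/
theorem exists_diagPerm_eq {p : ℕ} {C U : Matrix (Fin p) (Fin p) ℂ} (hC : IsUnit C)
    (h : ∀ y j, (C *ᵥ y) j ^ 2 = ∑ k, U j k * y k ^ 2) :
    ∃ (ν : Equiv.Perm (Fin p)) (d : Fin p → ℂ), (∀ i, d i ≠ 0) ∧ C = diagPerm ν d := by
  have hsq : ∀ j k, C j k ^ 2 = U j k := by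
    intro j k
    have := h (Pi.single k 1) j
    rw [Matrix.mulVec_single_one] at this
    simpa [Pi.single_apply, ite_pow] using this
  -- No mixed terms occur in the square of a row, so each row has at most one non-zero entry;
  -- invertibility supplies one in every row and column.
  have hcross : ∀ j k l, k ≠ l → C j k * C j l = 0 := by
    intro j k l hkl
    have h1 := h (Pi.single k 1 + Pi.single l 1) j
    rw [Matrix.mulVec_add, Matrix.mulVec_single_one, Matrix.mulVec_single_one] at h1
    have h2 : ∑ m, U j m * (Pi.single k (1 : ℂ) + Pi.single l 1 : Fin p → ℂ) m ^ 2 =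
        U j k + U j l := by
      have : ∀ m, U j m * (Pi.single k (1 : ℂ) + Pi.single l 1 : Fin p → ℂ) m ^ 2 =
          (if m = k then U j m else 0) + (if m = l then U j m else 0) := by
        intro m
        simp only [Pi.add_apply, Pi.single_apply]
        by_cases h3 : m = k
        · have h4 : m ≠ l := fun h => hkl (h3.symm.trans h)
          simp [h3, hkl]
        · by_cases h4 : m = l
          · simp [h4, hkl.symm]
          · simp [h3, h4]
      rw [Finset.sum_congr rfl fun m _ => this m]
      simp [Finset.sum_add_distrib]
    rw [h2, ← hsq, ← hsq] at h1
    simp only [Pi.add_apply, Matrix.col_apply] at h1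
    linear_combination h1 / 2
  have hinj : Function.Injective C.mulVec := Matrix.mulVec_injective_iff_isUnit.2 hC
  have hinj' : Function.Injective C.vecMul := Matrix.vecMul_injective_iff_isUnit.2 hC
  have hrow : ∀ j, ∃ k, C j k ≠ 0 := by
    intro j
    by_contra! hj
    have h1 : C.vecMul (Pi.single j 1) = C.vecMul 0 := by
      rw [Matrix.single_one_vecMul, Matrix.zero_vecMul]
      exact funext hj
    have := congrFun (hinj' h1) j
    simp at this
  choose ν hν using hrow
  have hzero : ∀ j k, k ≠ ν j → C j k = 0 := fun j k hk =>
    (mul_eq_zero.1 (hcross j k _ hk)).resolve_right (hν j)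
  have hsurj : Function.Surjective ν := by
    intro k
    by_contra! hk
    have h1 : C *ᵥ (Pi.single k 1) = C *ᵥ 0 := by
      rw [Matrix.mulVec_single_one, Matrix.mulVec_zero]
      exact funext fun j => hzero j k (hk j).symm
    have := congrFun (hinj h1) k
    simp at this
  refine ⟨Equiv.ofBijective ν ⟨Finite.injective_iff_surjective.2 hsurj, hsurj⟩,
    fun j => C j (ν j), hν, ?_⟩
  ext j k
  simp only [diagPerm, Matrix.of_apply]
  split_ifs with hk
  · rw [hk]
    rfl
  · exact hzero j k hk

theorem map_star_mulVec {p : ℕ} (P : Matrix (Fin p) (Fin p) ℂ) (x : Fin p → ℂ) :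
    P.map star *ᵥ star x = star (P *ᵥ x) := by
  ext i
  simp [Matrix.mulVec, dotProduct, star_sum]

theorem isUnit_map_star {p : ℕ} {P : Matrix (Fin p) (Fin p) ℂ} (hP : IsUnit P) :
    IsUnit (P.map star) := by
  have := hP.map (starRingEnd ℂ).mapMatrix
  exact this

/-- After complexification x and w = x̄ are independent. The terms in w alone force C = A₂'P̄A₂⁻¹ to
be monomial, the mixed terms give the equation for A₁', and the terms in x alone are absorbed by h.
-/
theorem quadEquiv_sqForm_iff {p : ℕ} {A₁ A₂ A₁' A₂' : Matrix (Fin p) (Fin p) ℂ} (h₂ : IsUnit A₂)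
    (h₂' : IsUnit A₂') : QuadEquiv (sqForm A₁ A₂) (sqForm A₁' A₂') ↔
      ∃ (P : Matrix (Fin p) (Fin p) ℂ) (ν : Equiv.Perm (Fin p)) (d : Fin p → ℂ), IsUnit P ∧
        (∀ i, d i ≠ 0) ∧ A₁' * P = diagPerm ν d * A₁ ∧ A₂' * P.map star = diagPerm ν d * A₂ := by
  constructor
  · rintro ⟨P₀, U, h, H⟩
    set P := LinearMap.toMatrix' P₀.toLinearMap with hPdef
    have hPx : ∀ x, P *ᵥ x = P₀ x := fun x => by rw [hPdef, LinearMap.toMatrix'_mulVec]; rfl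
    have hP : IsUnit P := by
      rw [← Matrix.mulVec_injective_iff_isUnit]
      intro x y hxy
      simp only [hPx] at hxy
      exact P₀.injective hxy
    let L : Matrix (Fin p) (Fin p) ℂ → Matrix (Fin p) (Fin p) ℂ → C2 p →ₗ[ℂ] (Fin p → ℂ) :=
      fun A B => A.mulVecLin.comp (LinearMap.fst ℂ _ _) + B.mulVecLin.comp (LinearMap.snd ℂ _ _)
    have hL : ∀ A B x w, L A B (x, w) = A *ᵥ x + B *ᵥ w := fun A B x w => rfl
    let m : (Fin p → ℂ) →ₗ[ℂ] (Fin p → ℂ) →ₗ[ℂ] (Fin p → ℂ) := LinearMap.mul ℂ (Fin p → ℂ)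
    have hpol : ∀ x w, (L (A₁' * P) (A₂' * P.map star) (x, w)) ^ 2 =
        U ((L A₁ A₂ (x, w)) ^ 2) + h x x := by
      intro x w
      have := bilinear_diag_eq_zero
        (m.compl₁₂ (L (A₁' * P) (A₂' * P.map star)) (L (A₁' * P) (A₂' * P.map star))
          - (m.compl₁₂ (L A₁ A₂) (L A₁ A₂)).compr₂ U.toLinearMap
          - h.compl₁₂ (LinearMap.fst ℂ _ _) (LinearMap.fst ℂ _ _)) (fun x => by
            have h1 : sqForm A₁' A₂' (P₀ x) = (L (A₁' * P) (A₂' * P.map star) (x, star x)) ^ 2 := by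
              ext j
              simp only [sqForm, hL, Pi.pow_apply, ← Matrix.mulVec_mulVec, map_star_mulVec, hPx]
            have h2 : sqForm A₁ A₂ x = (L A₁ A₂ (x, star x)) ^ 2 := rfl
            have h3 := H x
            rw [h1, h2] at h3
            simp only [LinearMap.sub_apply, LinearMap.compl₁₂_apply, LinearMap.compr₂_apply, m,
              LinearMap.mul_apply', ← pow_two, h3]
            simp) (x, w)
      simp only [LinearMap.sub_apply, LinearMap.compl₁₂_apply, LinearMap.compr₂_apply, m,
        LinearMap.mul_apply', ← pow_two] at this
      rw [sub_sub] at this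
      exact sub_eq_zero.1 this
    have hU : ∀ y j, U y j = ∑ k, LinearMap.toMatrix' U.toLinearMap j k * y k := by
      intro y j
      have : U y = LinearMap.toMatrix' U.toLinearMap *ᵥ y := by
        rw [LinearMap.toMatrix'_mulVec]; rfl
      rw [this]; rfl
    set V := LinearMap.toMatrix' U.toLinearMap
    obtain ⟨W, hW⟩ := h₂.exists_right_inv
    have hW' : W * A₂ = 1 := mul_eq_one_comm.1 hW
    have hdiag : ∀ w j, ((A₂' * P.map star) *ᵥ w) j ^ 2 = ∑ k, V j k * ((A₂ *ᵥ w) k) ^ 2 := by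
      intro w j
      have := congrFun (hpol 0 w) j
      simpa [hL, hU] using this
    obtain ⟨ν, d, hd, hC⟩ := exists_diagPerm_eq (C := A₂' * P.map star * W) (U := V)
      ((h₂'.mul (isUnit_map_star hP)).mul (IsUnit.of_mul_eq_one _ hW')) (fun y j => by
        rw [← Matrix.mulVec_mulVec, hdiag]
        simp [Matrix.mulVec_mulVec, hW])
    have hC2 : A₂' * P.map star = diagPerm ν d * A₂ := by
      rw [← hC, Matrix.mul_assoc _ W, hW', Matrix.mul_one]
    refine ⟨P, ν, d, hP, hd, ?_, hC2⟩
    refine Matrix.ext_of_mulVec_single fun i => ?_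
    generalize (Pi.single i 1 : Fin p → ℂ) = x
    ext j
    -- The mixed part in x and w, taken at the w for which A₂w is the basis vector of index ν j:
    -- only the summand k = ν j survives.
    have hmix : ((A₁' * P) *ᵥ x) j * ((A₂' * P.map star) *ᵥ (W *ᵥ Pi.single (ν j) 1)) j =
        ∑ k, V j k * ((A₁ *ᵥ x) k * (A₂ *ᵥ (W *ᵥ Pi.single (ν j) 1)) k) := by
      set w := W *ᵥ Pi.single (ν j) (1 : ℂ)
      have e1 := congrFun (hpol x w) j
      have e2 := congrFun (hpol x 0) j
      have e3 := hdiag w j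
      simp only [hL, Pi.add_apply, Pi.pow_apply, hU, Matrix.mulVec_zero, add_zero] at e1 e2
      have e4 : ∑ k, V j k * ((A₁ *ᵥ x) k + (A₂ *ᵥ w) k) ^ 2 =
          ∑ k, V j k * (A₁ *ᵥ x) k ^ 2 + 2 * ∑ k, V j k * ((A₁ *ᵥ x) k * (A₂ *ᵥ w) k)
            + ∑ k, V j k * (A₂ *ᵥ w) k ^ 2 := by
        rw [Finset.mul_sum, ← Finset.sum_add_distrib, ← Finset.sum_add_distrib]
        exact Finset.sum_congr rfl fun k _ => by ring
      rw [e4] at e1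
      linear_combination (e1 - e2 - e3) / 2
    have hVd : V j (ν j) = d j ^ 2 := by
      have := hdiag (W *ᵥ Pi.single (ν j) 1) j
      rw [hC2, ← Matrix.mulVec_mulVec, Matrix.mulVec_mulVec _ A₂ W, hW, Matrix.one_mulVec,
        diagPerm_mulVec] at this
      simpa [Pi.single_apply, ite_pow] using this.symm
    rw [hC2, ← Matrix.mulVec_mulVec _ (diagPerm ν d), Matrix.mulVec_mulVec _ A₂ W, hW,
      Matrix.one_mulVec, diagPerm_mulVec] at hmix
    have hmix' : ((A₁' * P) *ᵥ x) j * d j = d j ^ 2 * (A₁ *ᵥ x) (ν j) := by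
      rw [← hVd]
      simpa [Pi.single_apply] using hmix
    rw [← Matrix.mulVec_mulVec _ (diagPerm ν d), diagPerm_mulVec]
    exact mul_right_cancel₀ (hd j) (by rw [hmix']; ring)
  · rintro ⟨P, ν, d, hP, hd, e1, e2⟩
    let U₀ : (Fin p → ℂ) →ₗ[ℂ] (Fin p → ℂ) :=
      { toFun := fun y i => d i ^ 2 * y (ν i)
        map_add' := fun x y => by ext i; simp [mul_add]
        map_smul' := fun c y => by ext i; simp [mul_left_comm] }
    have hU : Function.Injective U₀ := by
      intro x y hxy
      ext i
      have := congrFun hxy (ν.symm i)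
      simpa [U₀, hd] using this
    refine ⟨LinearEquiv.ofInjectiveEndo P.mulVecLin (Matrix.mulVec_injective_iff_isUnit.2 hP),
      LinearEquiv.ofInjectiveEndo U₀ hU, 0, fun x => ?_⟩
    ext i
    change sqForm A₁' A₂' (P *ᵥ x) i = d i ^ 2 * sqForm A₁ A₂ x (ν i) + 0
    rw [sqForm, ← map_star_mulVec, Matrix.mulVec_mulVec, Matrix.mulVec_mulVec, e1, e2,
      ← Matrix.mulVec_mulVec, ← Matrix.mulVec_mulVec, ← Matrix.mulVec_add, diagPerm_mulVec, sqForm]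
    ring

/-! ### Equivalences between normal quadrics -/

section

variable {p : ℕ}

theorem normalQuadric_eq (B : Matrix (Fin p) (Fin p) ℂ) (Γ : BishopInvariants p) :
    normalQuadric B Γ = graphSet (sqForm B (-((2 : ℂ) • (B * Γ.mat)))) := by
  ext x
  have h : B *ᵥ (x.1 - (2 : ℂ) • Γ.mat *ᵥ star x.1) =
      B *ᵥ x.1 + (-((2 : ℂ) • (B * Γ.mat))) *ᵥ star x.1 := by
    rw [Matrix.mulVec_sub, Matrix.mulVec_smul, Matrix.mulVec_mulVec, Matrix.neg_mulVec,
      Matrix.smul_mulVec, sub_eq_add_neg]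
  simp only [normalQuadric, graphSet, Set.mem_ofPred_eq, funext_iff, sqForm, h]

theorem BishopInvariants.isUnit_mat (Γ : BishopInvariants p) : IsUnit Γ.mat := by
  have h : IsUnit (Γ.mat * Γ.mat.map star) := by
    rw [Γ.mat_mul_map_star, Matrix.isUnit_iff_isUnit_det, Matrix.det_diagonal, isUnit_iff_ne_zero]
    exact Finset.prod_ne_zero_iff.2 fun i _ => Γ.delta_ne_zero i
  rw [Matrix.isUnit_iff_isUnit_det, Matrix.det_mul] at h
  exact (Matrix.isUnit_iff_isUnit_det _).2 (isUnit_of_mul_isUnit_left h)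

theorem isUnit_neg_two_smul {A : Matrix (Fin p) (Fin p) ℂ} (hA : IsUnit A) :
    IsUnit (-((2 : ℂ) • A)) :=
  (hA.smul (Units.mk0 (2 : ℂ) two_ne_zero)).neg

/-- Substituting B'P for CB and cancelling B' leaves a consimilarity between the two γ-matrices,
free of B, B' and C. -/
theorem quadEquiv_normal_iff {B B' : Matrix (Fin p) (Fin p) ℂ} (hB : IsUnit B) (hB' : IsUnit B')
    {Γ Γ' : BishopInvariants p} :
    QuadEquiv (sqForm B (-((2 : ℂ) • (B * Γ.mat)))) (sqForm B' (-((2 : ℂ) • (B' * Γ'.mat)))) ↔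
      ∃ (P : Matrix (Fin p) (Fin p) ℂ) (ν : Equiv.Perm (Fin p)) (d : Fin p → ℂ), IsUnit P ∧
        (∀ i, d i ≠ 0) ∧ B' * P = diagPerm ν d * B ∧ Γ'.mat * P.map star = P * Γ.mat := by
  rw [quadEquiv_sqForm_iff (isUnit_neg_two_smul (hB.mul Γ.isUnit_mat))
    (isUnit_neg_two_smul (hB'.mul Γ'.isUnit_mat))]
  refine exists_congr fun P => exists_congr fun ν => exists_congr fun d =>
    and_congr_right fun hP => and_congr_right fun hd => and_congr_right fun h1 => ?_
  rw [Matrix.neg_mul, Matrix.mul_neg, neg_inj, Matrix.smul_mul, Matrix.mul_smul, ← Matrix.mul_assoc,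
    ← h1, Matrix.mul_assoc, Matrix.mul_assoc,
    (smul_right_injective (Matrix (Fin p) (Fin p) ℂ) (two_ne_zero (α := ℂ))).eq_iff]
  exact hB'.mul_right_inj

theorem delta_mul_eq {Γ Γ' : BishopInvariants p} {P : Matrix (Fin p) (Fin p) ℂ}
    (h : Γ'.mat * P.map star = P * Γ.mat) (i j : Fin p) :
    Γ'.delta i * P i j = P i j * Γ.delta j := by
  have h1 : Γ'.mat.map star * P = P.map star * Γ.mat.map star := by
    have hPP : (P.map star).map (starRingEnd ℂ) = P := by
      ext i j
      simp
    have := congrArg (fun M => M.map (starRingEnd ℂ)) h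
    simp only [Matrix.map_mul, hPP] at this
    exact this
  have h2 : Matrix.diagonal Γ'.delta * P = P * Matrix.diagonal Γ.delta := by
    rw [← Γ.mat_mul_map_star, ← Γ'.mat_mul_map_star, Matrix.mul_assoc, h1, ← Matrix.mul_assoc, h,
      Matrix.mul_assoc]
  have := congrFun (congrFun h2 i) j
  rwa [Matrix.diagonal_mul, Matrix.mul_diagonal] at this

theorem exists_ne_zero_of_isUnit {P : Matrix (Fin p) (Fin p) ℂ} (hP : IsUnit P) (j : Fin p) :
    ∃ i, P i j ≠ 0 := by
  by_contra! h
  have h1 : P *ᵥ Pi.single j 1 = P *ᵥ 0 := by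
    rw [Matrix.mulVec_single_one, Matrix.mulVec_zero]
    exact funext h
  have := congrFun (Matrix.mulVec_injective_iff_isUnit.2 hP h1) j
  simp at this

/-- A non-zero entry in each column of P matches every δ with an equal δ'; the matching is
injective, hence bijective. No ordering is required, so simplicity also passes to unordered
invariants. -/
theorem delta_injective_and_range_eq {Γ Γ' : BishopInvariants p} {P : Matrix (Fin p) (Fin p) ℂ}
    (hP : IsUnit P) (h : Γ'.mat * P.map star = P * Γ.mat) (hinj : Function.Injective Γ.delta) :
    Function.Injective Γ'.delta ∧ Set.range Γ'.delta = Set.range Γ.delta := by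
  choose π hπ using exists_ne_zero_of_isUnit hP
  have hδ : ∀ j, Γ'.delta (π j) = Γ.delta j := fun j =>
    mul_right_cancel₀ (hπ j) ((delta_mul_eq h (π j) j).trans (mul_comm _ _))
  have hπinj : Function.Injective π := fun j k hjk => hinj (by rw [← hδ, ← hδ, hjk])
  have hπsurj := Finite.injective_iff_surjective.1 hπinj
  constructor
  · intro a b hab
    obtain ⟨j, rfl⟩ := hπsurj a
    obtain ⟨k, rfl⟩ := hπsurj b
    rw [hδ, hδ] at hab
    rw [hinj hab]
  · rw [← hπsurj.range_comp Γ'.delta]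
    exact congrArg Set.range (funext hδ)

/-- P commutes with the diagonal matrix of the distinct δ's, so it is diagonal; the entry of the
consimilarity at an index and its partner is the conjugation condition. -/
theorem exists_diagonal_of_commute {Γ : BishopInvariants p} {P : Matrix (Fin p) (Fin p) ℂ}
    (hP : IsUnit P) (h : Γ.mat * P.map star = P * Γ.mat) (hinj : Function.Injective Γ.delta) :
    ∃ a : Fin p → ℂ, P = Matrix.diagonal a ∧ (∀ i, a i ≠ 0) ∧ ∀ i, a (Γ.prt i) = conj (a i) := by
  have hoff : ∀ i j, i ≠ j → P i j = 0 := by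
    intro i j hij
    by_contra hne
    refine hij (hinj (mul_right_cancel₀ hne ((delta_mul_eq h i j).trans (mul_comm _ _))))
  have hdiag : P = Matrix.diagonal fun i => P i i := by
    ext i j
    rw [Matrix.diagonal_apply]
    split_ifs with hij
    · rw [hij]
    · exact hoff i j hij
  refine ⟨fun i => P i i, hdiag, fun i => ?_, fun i => ?_⟩
  · obtain ⟨k, hk⟩ := exists_ne_zero_of_isUnit hP i
    have : k = i := by
      by_contra hne
      exact hk (hoff k i hne)
    rwa [this] at hk
  · have h1 := congrFun (congrFun h i) (Γ.prt i)
    rw [hdiag, Matrix.diagonal_map (by simp), Matrix.mul_diagonal, Matrix.diagonal_mul, Γ.mat_apply,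
      if_pos rfl] at h1
    have h2 : star (P (Γ.prt i) (Γ.prt i)) = P i i :=
      mul_left_cancel₀ (Γ.gamma_ne_zero i) (h1.trans (mul_comm _ _))
    change P (Γ.prt i) (Γ.prt i) = conj (P i i)
    rw [← h2]
    simp

theorem diagonal_commute {Γ : BishopInvariants p} {a : Fin p → ℂ}
    (ha : ∀ i, a (Γ.prt i) = conj (a i)) :
    Γ.mat * (Matrix.diagonal a).map star = Matrix.diagonal a * Γ.mat := by
  ext i j
  rw [Matrix.diagonal_map (by simp), Matrix.mul_diagonal, Matrix.diagonal_mul, Γ.mat_apply]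
  split_ifs with h
  · rw [h, ha]
    simp [mul_comm]
  · simp

theorem extendedBishopEquiv_iff {Γ : BishopInvariants p} (hinj : Function.Injective Γ.delta)
    {B B' : Matrix (Fin p) (Fin p) ℂ} (hB : IsUnit B) (hB' : IsUnit B') :
    QuadEquiv (sqForm B (-((2 : ℂ) • (B * Γ.mat)))) (sqForm B' (-((2 : ℂ) • (B' * Γ.mat)))) ↔
      ExtendedBishopEquiv Γ B B' := by
  rw [quadEquiv_normal_iff hB hB']
  constructor
  · rintro ⟨P, ν, d, hP, hd, h1, h2⟩
    obtain ⟨a, rfl, ha, ha'⟩ := exists_diagonal_of_commute hP h2 hinj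
    -- R is P⁻¹, since B'P = CB.
    refine ⟨ν, d, fun i => (a i)⁻¹, hd, fun i => inv_ne_zero (ha i), fun i => by
      simp [ha'], ?_⟩
    rw [← h1, Matrix.mul_assoc, Matrix.diagonal_mul_diagonal]
    simp [ha]
  · rintro ⟨ν, d, a, hd, ha, ha', h1⟩
    refine ⟨Matrix.diagonal fun i => (a i)⁻¹, ν, d, ?_, hd, ?_, ?_⟩
    · rw [Matrix.isUnit_iff_isUnit_det, Matrix.det_diagonal, isUnit_iff_ne_zero]
      exact Finset.prod_ne_zero_iff.2 fun i _ => inv_ne_zero (ha i)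
    · rw [h1, Matrix.mul_assoc, Matrix.diagonal_mul_diagonal]
      simp [ha]
    · exact diagonal_commute fun i => by simp [ha']

/-! ### Recovering ordered invariants from the set of δ's -/

namespace BishopInvariants

theorem ncard_lt_e (Γ : BishopInvariants p) (hinj : Function.Injective Γ.delta) :
    (Set.range Γ.delta ∩ {x | x.im = 0 ∧ x.re < 1 / 4}).ncard = Γ.e := by
  have h1 : Set.range Γ.delta ∩ {x | x.im = 0 ∧ x.re < 1 / 4} =
      Γ.delta '' {i : Fin p | (i : ℕ) < Γ.e} := by
    ext x
    constructor
    · rintro ⟨⟨i, rfl⟩, hi⟩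
      exact ⟨i, (Γ.lt_e_iff i).2 hi, rfl⟩
    · rintro ⟨i, hi, rfl⟩
      exact ⟨⟨i, rfl⟩, (Γ.lt_e_iff i).1 hi⟩
  have := Γ.sum_eq
  have h2 : ((↑) : Fin p → ℕ) '' {i : Fin p | (i : ℕ) < Γ.e} = Set.Iio Γ.e := by
    ext k
    constructor
    · rintro ⟨i, hi, rfl⟩
      exact hi
    · intro hk
      have hk' : k < Γ.e := hk
      exact ⟨⟨k, by omega⟩, hk, rfl⟩
  rw [h1, Set.ncard_image_of_injective _ hinj, ← Set.ncard_image_of_injective _ Fin.val_injective,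
    h2, ← Finset.coe_Iio, Set.ncard_coe_finset, Nat.card_Iio]

theorem ncard_hyperbolic (Γ : BishopInvariants p) (hinj : Function.Injective Γ.delta) :
    (Set.range Γ.delta ∩ {x | x.im = 0 ∧ 1 / 4 < x.re}).ncard = Γ.h := by
  have h1 : Set.range Γ.delta ∩ {x | x.im = 0 ∧ 1 / 4 < x.re} =
      Γ.delta '' {i : Fin p | Γ.e ≤ (i : ℕ) ∧ (i : ℕ) < Γ.e + Γ.h} := by
    ext x
    constructor
    · rintro ⟨⟨i, rfl⟩, hi⟩
      exact ⟨i, (Γ.mem_hyperbolic_iff i).2 hi, rfl⟩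
    · rintro ⟨i, hi, rfl⟩
      exact ⟨⟨i, rfl⟩, (Γ.mem_hyperbolic_iff i).1 hi⟩
  have := Γ.sum_eq
  have h2 : ((↑) : Fin p → ℕ) '' {i : Fin p | Γ.e ≤ (i : ℕ) ∧ (i : ℕ) < Γ.e + Γ.h} =
      Set.Ico Γ.e (Γ.e + Γ.h) := by
    ext k
    constructor
    · rintro ⟨i, hi, rfl⟩
      exact hi
    · intro hk
      have hk' := hk.2
      exact ⟨⟨k, by omega⟩, hk, rfl⟩
  rw [h1, Set.ncard_image_of_injective _ hinj, ← Set.ncard_image_of_injective _ Fin.val_injective,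
    h2, ← Finset.coe_Ico, Set.ncard_coe_finset, Nat.card_Ico, Nat.add_sub_cancel_left]

/-- The two roots of x(1 - x) = δ sum to 1, so at most one has real part below 1/2. -/
theorem eq_of_mul_one_sub_eq {x y : ℂ} (hx : x.re < 1 / 2) (hy : y.re < 1 / 2)
    (h : x * (1 - x) = y * (1 - y)) : x = y := by
  have h1 : (x - y) * (1 - x - y) = 0 := by linear_combination h
  rcases mul_eq_zero.1 h1 with h2 | h2
  · exact sub_eq_zero.1 h2
  · have := congrArg Complex.re h2
    simp only [Complex.sub_re, Complex.one_re, Complex.zero_re] at this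
    linarith

theorem image_subset_image {Γ Γ' : BishopInvariants p} {I : Finset (Fin p)}
    (hr : Set.range Γ'.delta = Set.range Γ.delta)
    (H : ∀ i ∈ I, ∀ k, Γ'.delta k = Γ.delta i → k ∈ I ∧ Γ'.γ k = Γ.γ i) :
    Γ.γ '' I ⊆ Γ'.γ '' I := by
  rintro _ ⟨i, hi, rfl⟩
  obtain ⟨k, hk⟩ : Γ.delta i ∈ Set.range Γ'.delta := hr ▸ Set.mem_range_self i
  obtain ⟨h1, h2⟩ := H i hi k hk
  exact ⟨k, h1, h2⟩

theorem gamma_elliptic_of_delta_eq {Γ Γ' : BishopInvariants p} (he : Γ.e = Γ'.e) {i k : Fin p}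
    (hi : (i : ℕ) < Γ.e) (hk : Γ'.delta k = Γ.delta i) :
    (k : ℕ) < Γ.e ∧ Γ'.γ k = Γ.γ i := by
  have h1 : (k : ℕ) < Γ'.e := by
    rw [Γ'.lt_e_iff, hk]
    exact (Γ.lt_e_iff i).1 hi
  obtain ⟨r, hr0, -, hr, hr2⟩ := Γ.delta_elliptic hi
  obtain ⟨r', hr0', -, hr', hr2'⟩ := Γ'.delta_elliptic h1
  refine ⟨he ▸ h1, ?_⟩
  rw [hr2, hr2', Complex.ofReal_inj, pow_left_inj₀ hr0'.le hr0.le two_ne_zero] at hk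
  rw [hr, hr', hk]

theorem gamma_hyperbolic_of_delta_eq {Γ Γ' : BishopInvariants p} (he : Γ.e = Γ'.e)
    (hh : Γ.h = Γ'.h) {i k : Fin p} (hi : Γ.e ≤ (i : ℕ) ∧ (i : ℕ) < Γ.e + Γ.h)
    (hk : Γ'.delta k = Γ.delta i) :
    (Γ.e ≤ (k : ℕ) ∧ (k : ℕ) < Γ.e + Γ.h) ∧ Γ'.γ k = Γ.γ i := by
  have h1 : Γ'.e ≤ (k : ℕ) ∧ (k : ℕ) < Γ'.e + Γ'.h := by
    rw [Γ'.mem_hyperbolic_iff, hk]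
    exact (Γ.mem_hyperbolic_iff i).1 hi
  obtain ⟨r, hr0, hr, hr2⟩ := Γ.delta_hyperbolic hi.1 hi.2
  obtain ⟨r', hr0', hr', hr2'⟩ := Γ'.delta_hyperbolic h1.1 h1.2
  refine ⟨by omega, ?_⟩
  rw [hr2, hr2', Complex.ofReal_inj, pow_left_inj₀ (by linarith) (by linarith) two_ne_zero] at hk
  rw [hr, hr', hk]

theorem gamma_complex_of_delta_eq {Γ Γ' : BishopInvariants p} (he : Γ.e = Γ'.e)
    (hh : Γ.h = Γ'.h) (hs : Γ.s = Γ'.s) {i k : Fin p}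
    (hi : Γ.e + Γ.h ≤ (i : ℕ) ∧ (i : ℕ) < Γ.e + Γ.h + Γ.s) (hk : Γ'.delta k = Γ.delta i) :
    (Γ.e + Γ.h ≤ (k : ℕ) ∧ (k : ℕ) < Γ.e + Γ.h + Γ.s) ∧ Γ'.γ k = Γ.γ i := by
  have h1 : Γ'.e + Γ'.h ≤ (k : ℕ) ∧ (k : ℕ) < Γ'.e + Γ'.h + Γ'.s := by
    rw [Γ'.mem_complex_iff, hk]
    exact (Γ.mem_complex_iff i).1 hi
  refine ⟨by omega, ?_⟩
  rw [(Γ.delta_complex hi.1 hi.2).1, (Γ'.delta_complex h1.1 h1.2).1] at hk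
  exact eq_of_mul_one_sub_eq (Γ'.complex k h1.1 h1.2).1 (Γ.complex i hi.1 hi.2).1 hk

/-- The key by which complex invariants are ordered. -/
noncomputable def complexKey (g : ℂ) : ℝ ×ₗ ℝ :=
  toLex ((conj (g⁻¹ - 1)).arg, ‖conj (g⁻¹ - 1)‖)

theorem ordered_iff (Γ : BishopInvariants p) : Γ.Ordered ↔
    StrictMonoOn ((fun g : ℂ => -g.re) ∘ Γ.γ) {i : Fin p | (i : ℕ) < Γ.e} ∧
    StrictMonoOn (Complex.re ∘ Γ.γ) {i : Fin p | Γ.e ≤ (i : ℕ) ∧ (i : ℕ) < Γ.e + Γ.h} ∧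
    StrictMonoOn (complexKey ∘ Γ.γ)
      {i : Fin p | Γ.e + Γ.h ≤ (i : ℕ) ∧ (i : ℕ) < Γ.e + Γ.h + Γ.s} := by
  have hlex : ∀ i j, complexKey (Γ.γ i) < complexKey (Γ.γ j) ↔ (Γ.mu i).arg < (Γ.mu j).arg ∨
      ((Γ.mu i).arg = (Γ.mu j).arg ∧ ‖Γ.mu i‖ < ‖Γ.mu j‖) := fun i j => Prod.Lex.toLex_lt_toLex
  constructor
  · rintro ⟨h1, h2, h3⟩
    refine ⟨fun i hi j hj hij => neg_lt_neg (h1 i j hij hj), fun i hi j hj hij =>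
      h2 i j hi.1 hij hj.2, fun i hi j hj hij => (hlex i j).2 (h3 i j hi.1 hij hj.2)⟩
  · rintro ⟨h1, h2, h3⟩
    refine ⟨fun i j hij hj => ?_, fun i j hi hij hj => ?_, fun i j hi hij hj => ?_⟩
    · have hij' : (i : ℕ) < j := hij
      exact neg_lt_neg_iff.1 (h1 (hij'.trans hj) hj hij)
    · have hij' : (i : ℕ) < j := hij
      exact h2 ⟨hi, hij'.trans hj⟩ ⟨hi.trans hij'.le, hj⟩ hij
    · have hij' : (i : ℕ) < j := hij
      exact (hlex i j).1 (h3 ⟨hi, hij'.trans hj⟩ ⟨hi.trans hij'.le, hj⟩ hij)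

/-- Ordered invariants with simple spectrum are determined by the set of the numbers `delta`. -/
theorem eq_of_range_delta_eq {Γ Γ' : BishopInvariants p} (hΓ : Γ.Ordered) (hΓ' : Γ'.Ordered)
    (hinj : Function.Injective Γ.delta) (hinj' : Function.Injective Γ'.delta)
    (hr : Set.range Γ'.delta = Set.range Γ.delta) : Γ = Γ' := by
  classical
  have he : Γ.e = Γ'.e := by rw [← Γ.ncard_lt_e hinj, ← Γ'.ncard_lt_e hinj', hr]
  have hh : Γ.h = Γ'.h := by rw [← Γ.ncard_hyperbolic hinj, ← Γ'.ncard_hyperbolic hinj', hr]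
  have hs : Γ.s = Γ'.s := by
    have := Γ.sum_eq
    have := Γ'.sum_eq
    omega
  rw [ordered_iff] at hΓ hΓ'
  rw [← he, ← hh, ← hs] at hΓ'
  -- Within each block δ determines γ, so both families of γ's have the same image; monotonicity of
  -- the key then makes them equal index by index.
  have H1 : ∀ i : Fin p, (i : ℕ) < Γ.e → Γ.γ i = Γ'.γ i := by
    intro i hi
    refine eqOn_of_strictMonoOn_key (Finset.univ.filter fun i : Fin p => (i : ℕ) < Γ.e)
      (fun g : ℂ => -g.re) (by simpa using hΓ.1) (by simpa using hΓ'.1)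
      (Set.Subset.antisymm (image_subset_image hr fun i hi k hk => ?_)
        (image_subset_image hr.symm fun i hi k hk => ?_)) (by simpa using hi)
    · simpa using gamma_elliptic_of_delta_eq he (by simpa using hi) hk
    · simpa [he] using gamma_elliptic_of_delta_eq he.symm (by simpa [he] using hi) hk
  have H2 : ∀ i : Fin p, Γ.e ≤ (i : ℕ) ∧ (i : ℕ) < Γ.e + Γ.h → Γ.γ i = Γ'.γ i := by
    intro i hi
    refine eqOn_of_strictMonoOn_key
      (Finset.univ.filter fun i : Fin p => Γ.e ≤ (i : ℕ) ∧ (i : ℕ) < Γ.e + Γ.h)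
      Complex.re (by simpa using hΓ.2.1) (by simpa using hΓ'.2.1)
      (Set.Subset.antisymm (image_subset_image hr fun i hi k hk => ?_)
        (image_subset_image hr.symm fun i hi k hk => ?_)) (by simpa using hi)
    · simpa using gamma_hyperbolic_of_delta_eq he hh (by simpa using hi) hk
    · simpa [he, hh] using
        gamma_hyperbolic_of_delta_eq he.symm hh.symm (by simpa [he, hh] using hi) hk
  have H3 : ∀ i : Fin p, Γ.e + Γ.h ≤ (i : ℕ) ∧ (i : ℕ) < Γ.e + Γ.h + Γ.s → Γ.γ i = Γ'.γ i := by
    intro i hi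
    refine eqOn_of_strictMonoOn_key
      (Finset.univ.filter fun i : Fin p => Γ.e + Γ.h ≤ (i : ℕ) ∧ (i : ℕ) < Γ.e + Γ.h + Γ.s)
      complexKey (by simpa using hΓ.2.2) (by simpa using hΓ'.2.2)
      (Set.Subset.antisymm (image_subset_image hr fun i hi k hk => ?_)
        (image_subset_image hr.symm fun i hi k hk => ?_)) (by simpa using hi)
    · simpa using gamma_complex_of_delta_eq he hh hs (by simpa using hi) hk
    · simpa [he, hh, hs] using
        gamma_complex_of_delta_eq he.symm hh.symm hs.symm (by simpa [he, hh, hs] using hi) hk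
  have hγ : Γ.γ = Γ'.γ := by
    ext1 i
    rcases Γ.block_cases i with h | h | h | ⟨j, h, rfl⟩
    · exact H1 i h
    · exact H2 i h
    · exact H3 i h
    · have hprt : Γ'.prt j = Γ.prt j := by simp only [prt, he, hh, hs]
      have h1 := Γ.complex_partner j h.1 h.2
      have h2 := Γ'.complex_partner j (by omega) (by omega)
      change Γ.γ (Γ.prt j) = _ at h1
      change Γ'.γ (Γ'.prt j) = _ at h2
      rw [h1, ← hprt, h2, H3 j h]
  cases Γ
  cases Γ'
  simp only at he hh hs hγ
  subst he hh hs hγ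
  rfl

end BishopInvariants

end

section

variable {p : ℕ}

/-- δ separates the blocks and determines γ inside each, where the strict order makes γ injective.
Partner indices reduce to the complex block by conjugation. -/
theorem BishopInvariants.Ordered.delta_injective {Γ : BishopInvariants p} (h : Γ.Ordered) :
    Function.Injective Γ.delta := by
  rw [Γ.ordered_iff] at h
  have hcomplex : ∀ i j : Fin p, Γ.e + Γ.h ≤ (i : ℕ) ∧ (i : ℕ) < Γ.e + Γ.h + Γ.s →
      Γ.delta i = Γ.delta j → i = j := by
    intro i j hi hij
    obtain ⟨hj, hγ⟩ := BishopInvariants.gamma_complex_of_delta_eq rfl rfl rfl hi hij.symm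
    exact h.2.2.injOn hi hj (congrArg BishopInvariants.complexKey hγ.symm)
  intro i j hij
  rcases Γ.block_cases i with hi | hi | hi | ⟨i', hi, rfl⟩
  · obtain ⟨hj, hγ⟩ := BishopInvariants.gamma_elliptic_of_delta_eq rfl hi hij.symm
    exact h.1.injOn hi hj (congrArg (fun g : ℂ => -g.re) hγ.symm)
  · obtain ⟨hj, hγ⟩ := BishopInvariants.gamma_hyperbolic_of_delta_eq rfl rfl hi hij.symm
    exact h.2.1.injOn hi hj (congrArg Complex.re hγ.symm)
  · exact hcomplex i j hi hij
  · have h1 : Γ.delta i' = Γ.delta (Γ.prt j) := by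
      rw [Γ.delta_prt, ← hij, Γ.delta_prt, Complex.conj_conj]
    rw [hcomplex i' _ hi h1, Γ.prt_prt]

/-! ### From the spectrum of S to that of K̄K -/

theorem card_eigenvalues_le (f : Module.End ℂ (Fin p → ℂ)) (S : Finset ℂ)
    (hS : ∀ c ∈ S, ∃ v, v ≠ 0 ∧ f v = c • v) : S.card ≤ p := by
  choose v hv0 hv using fun c : S => hS c c.2
  have hLI : LinearIndependent ℂ v :=
    Module.End.eigenvectors_linearIndependent' f (fun c : S => (c : ℂ)) Subtype.val_injective v
      fun c => ⟨Module.End.mem_eigenspace_iff.2 (hv c), hv0 c⟩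
  simpa using hLI.fintype_card_le_finrank

/-- The eigenvalues of `S = T₁ T₂` lie over those of `(conj K) K`. -/
theorem eigenvector_of_composition {T : C2 p →ₗ[ℂ] C2 p} {K : Matrix (Fin p) (Fin p) ℂ}
    (hT : ∀ x, T x = (x.1, -x.2 - (2 : ℂ) • K *ᵥ x.1)) {μ : ℂ}
    (hμ : Module.End.HasEigenvalue (T.comp (secondInvolution T)) μ) :
    μ ≠ 0 ∧ ∃ v, v ≠ 0 ∧ (K.map star * K) *ᵥ v = ((1 + μ) ^ 2 / (4 * μ)) • v := by
  obtain ⟨⟨z, w⟩, hmem, h0⟩ := hμ.exists_hasEigenvector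
  have hT2 : secondInvolution T (z, w) = (-z - (2 : ℂ) • K.map star *ᵥ w, w) := by
    change rho0 p (T (star w, star z)) = _
    rw [hT]
    refine Prod.ext ?_ ?_
    · change star (-star z - (2 : ℂ) • K *ᵥ star w) = _
      rw [star_sub, star_neg, star_star, star_smul, ← map_star_mulVec, star_star]
      simp
    · exact star_star w
  have hS := Module.End.mem_eigenspace_iff.1 hmem
  rw [LinearMap.comp_apply, hT2, hT] at hS
  have e1 : -z - (2 : ℂ) • K.map star *ᵥ w = μ • z := congrArg Prod.fst hS
  have e2 : -w - (2 : ℂ) • K *ᵥ (-z - (2 : ℂ) • K.map star *ᵥ w) = μ • w := congrArg Prod.snd hS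
  rw [e1, Matrix.mulVec_smul] at e2
  have hμ0 : μ ≠ 0 := by
    rintro rfl
    have hw : w = 0 := by simpa using e2
    have hz : z = 0 := by simpa [hw] using e1
    exact h0 (by rw [hw, hz]; rfl)
  refine ⟨hμ0, ?_⟩
  -- Here the required eigenvalue is 0 and z may vanish; in that case w̄ is a kernel vector of K.
  by_cases hμ1 : μ = -1
  · subst hμ1
    have h1 : K *ᵥ z = 0 := by
      have : (2 : ℂ) • K *ᵥ z = 0 := by linear_combination (norm := module) e2
      exact (smul_eq_zero.1 this).resolve_left two_ne_zero
    have h2 : K.map star *ᵥ w = 0 := by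
      have : (2 : ℂ) • K.map star *ᵥ w = 0 := by linear_combination (norm := module) -e1
      exact (smul_eq_zero.1 this).resolve_left two_ne_zero
    by_cases hz : z = 0
    · have hw : star w ≠ 0 := fun hw => h0 (by rw [hz, star_eq_zero.1 hw]; rfl)
      refine ⟨star w, hw, ?_⟩
      have h3 : K *ᵥ star w = 0 := by
        have := map_star_mulVec K (star w)
        rw [star_star, h2] at this
        exact star_eq_zero.1 this.symm
      rw [← Matrix.mulVec_mulVec, h3]
      simp
    · refine ⟨z, hz, ?_⟩
      rw [← Matrix.mulVec_mulVec, h1]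
      simp
  · have hμ1' : 1 + μ ≠ 0 := fun h => hμ1 (by linear_combination h)
    have hw : (1 + μ) • w = -(2 * μ) • K *ᵥ z := by linear_combination (norm := module) -e2
    have hz : (1 + μ) • z = -(2 : ℂ) • K.map star *ᵥ w := by
      linear_combination (norm := module) -e1
    refine ⟨z, fun hz0 => ?_, ?_⟩
    · rw [hz0, Matrix.mulVec_zero, smul_zero] at hw
      exact h0 (by rw [hz0, (smul_eq_zero.1 hw).resolve_left hμ1']; rfl)
    · have h1 : (1 + μ) ^ 2 • z = (4 * μ) • (K.map star * K) *ᵥ z := by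
        calc (1 + μ) ^ 2 • z = (1 + μ) • (1 + μ) • z := by rw [smul_smul, pow_two]
          _ = -(2 : ℂ) • K.map star *ᵥ ((1 + μ) • w) := by
            rw [hz, Matrix.mulVec_smul, smul_comm]
          _ = (4 * μ) • (K.map star * K) *ᵥ z := by
            rw [hw, Matrix.mulVec_smul, Matrix.mulVec_mulVec, smul_smul]
            congr 1
            ring
      rw [div_eq_inv_mul, ← smul_smul, h1, smul_smul, inv_mul_cancel₀ (by simpa using hμ0),
        one_smul]

/-- If `S = T₁ T₂` has `2p` distinct eigenvalues then `(conj K) K` has `p` distinct ones, and none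
of them is `0` or `1`. -/
theorem exists_finset_eigenvalues {T : C2 p →ₗ[ℂ] C2 p} {K : Matrix (Fin p) (Fin p) ℂ}
    (hT : ∀ x, T x = (x.1, -x.2 - (2 : ℂ) • K *ᵥ x.1)) (hS : ConditionE T) :
    ∃ S : Finset ℂ, S.card = p ∧
      ∀ c ∈ S, c ≠ 0 ∧ c ≠ 1 ∧ ∃ v, v ≠ 0 ∧ (K.map star * K) *ᵥ v = c • v := by
  classical
  have hfin : {μ : ℂ | Module.End.HasEigenvalue (T.comp (secondInvolution T)) μ}.Finite :=
    Module.End.finite_hasEigenvalue _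
  set R := hfin.toFinset with hR
  have hRcard : R.card = 2 * p := by
    rw [← hS, hR, Set.ncard_eq_toFinset_card _ hfin]
  have hRmem : ∀ μ ∈ R, μ ≠ 0 ∧
      ∃ v, v ≠ 0 ∧ (K.map star * K) *ᵥ v = ((1 + μ) ^ 2 / (4 * μ)) • v := fun μ hμ =>
    eigenvector_of_composition hT (hfin.mem_toFinset.1 hμ)
  let κ : ℂ → ℂ := fun μ => (1 + μ) ^ 2 / (4 * μ)
  set S := R.image κ with hSdef
  have hSv : ∀ c ∈ S, ∃ v, v ≠ 0 ∧ (K.map star * K) *ᵥ v = c • v := by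
    intro c hc
    obtain ⟨μ, hμ, rfl⟩ := Finset.mem_image.1 hc
    exact (hRmem μ hμ).2
  have hSle : S.card ≤ p := card_eigenvalues_le (K.map star * K).mulVecLin S hSv
  have hfib2 : ∀ c, (R.filter (fun μ => κ μ = c)).card ≤ 2 := by
    intro c
    rcases (R.filter (fun μ => κ μ = c)).eq_empty_or_nonempty with h | ⟨μ, hμ⟩
    · simp [h]
    -- κ μ = κ ν factors as (ν - μ)(1 - μν) = 0.
    · refine (Finset.card_le_card (t := {μ, μ⁻¹}) fun ν hν => ?_).trans Finset.card_le_two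
      rw [Finset.mem_filter] at hμ hν
      have hμ0 := (hRmem μ hμ.1).1
      have hν0 := (hRmem ν hν.1).1
      have h1 : (1 + μ) ^ 2 / (4 * μ) = (1 + ν) ^ 2 / (4 * ν) := hμ.2.trans hν.2.symm
      rw [div_eq_div_iff (by simpa using hμ0) (by simpa using hν0)] at h1
      have h2 : (ν - μ) * (1 - μ * ν) = 0 := by linear_combination h1 / 4
      rw [Finset.mem_insert, Finset.mem_singleton]
      rcases mul_eq_zero.1 h2 with h3 | h3
      · exact Or.inl (sub_eq_zero.1 h3)
      · exact Or.inr (eq_inv_of_mul_eq_one_right (sub_eq_zero.1 h3).symm)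
  have hScard : S.card = p := by
    have : R.card ≤ 2 * S.card := Finset.card_le_mul_card_image (f := κ) R 2 (fun c _ => hfib2 c)
    omega
  -- With 2p points over p values and at most two over each, no fibre is a single point. This
  -- excludes 0 and 1, over which only μ = -1 and μ = 1 could lie.
  have hfib1 : ∀ c ∈ S, ∀ μ₀, (∀ μ ∈ R, κ μ = c → μ = μ₀) → False := by
    intro c hc μ₀ h
    have h1 : (R.filter (fun μ => κ μ = c)).card ≤ 1 := by
      refine (Finset.card_le_card (t := {μ₀}) fun μ hμ => ?_).trans (by simp)
      rw [Finset.mem_filter] at hμ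
      simpa using h μ hμ.1 hμ.2
    have h2 : (R.filter (fun μ => ¬ κ μ = c)).card ≤ 2 * (S.erase c).card := by
      refine Finset.card_le_mul_card_image_of_maps_to (f := κ) (fun μ hμ => ?_) 2 fun b _ => ?_
      · rw [Finset.mem_filter] at hμ
        exact Finset.mem_erase.2 ⟨hμ.2, Finset.mem_image_of_mem _ hμ.1⟩
      · refine (Finset.card_le_card fun μ hμ => ?_).trans (hfib2 b)
        rw [Finset.mem_filter] at hμ ⊢
        exact ⟨(Finset.mem_filter.1 hμ.1).1, hμ.2⟩
    have h3 := Finset.card_filter_add_card_filter_not (s := R) (fun μ => κ μ = c)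
    have h4 := Finset.card_erase_add_one hc
    omega
  refine ⟨S, hScard, fun c hc => ⟨?_, ?_, hSv c hc⟩⟩
  · rintro rfl
    refine hfib1 0 hc (-1) fun μ hμ h => ?_
    have hμ0 := (hRmem μ hμ).1
    rcases div_eq_zero_iff.1 h with h1 | h1
    · have := pow_eq_zero_iff two_ne_zero |>.1 h1
      linear_combination this
    · exact absurd h1 (by simpa using hμ0)
  · rintro rfl
    refine hfib1 1 hc 1 fun μ hμ h => ?_
    have hμ0 := (hRmem μ hμ).1
    have h1 : (1 + μ) ^ 2 = 4 * μ := (div_eq_one_iff_eq (by simpa using hμ0)).1 h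
    have h2 : (μ - 1) ^ 2 = 0 := by linear_combination h1
    exact sub_eq_zero.1 (pow_eq_zero_iff two_ne_zero |>.1 h2)

end

/-! ### Normal form under consimilarity -/

section

variable {p : ℕ}

/-- The antilinear map `v ↦ N (conj v)`. -/
def conjMulVec (N : Matrix (Fin p) (Fin p) ℂ) (v : Fin p → ℂ) : Fin p → ℂ := N *ᵥ star v

theorem conjMulVec_smul (N : Matrix (Fin p) (Fin p) ℂ) (c : ℂ) (v : Fin p → ℂ) :
    conjMulVec N (c • v) = conj c • conjMulVec N v := by
  rw [conjMulVec, star_smul, Matrix.mulVec_smul]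
  rfl

theorem conjMulVec_conjMulVec (N : Matrix (Fin p) (Fin p) ℂ) (v : Fin p → ℂ) :
    conjMulVec N (conjMulVec N v) = (N * N.map star) *ᵥ v := by
  rw [conjMulVec, conjMulVec, ← map_star_mulVec, star_star, Matrix.mulVec_mulVec]

/-- Take γ = 1/2 + t with t² = 1/4 - δ and Re t < 0; then 2 Re t · Im t = -Im δ < 0 forces Im t > 0.
-/
theorem exists_gamma_of_im_pos {δ : ℂ} (hδ : 0 < δ.im) :
    ∃ g : ℂ, g * (1 - g) = δ ∧ g.re < 1 / 2 ∧ 0 < g.im := by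
  obtain ⟨t, ht⟩ : ∃ t : ℂ, t ^ 2 = 1 / 4 - δ ∧ t.re < 0 := by
    obtain ⟨t, ht⟩ := IsAlgClosed.exists_pow_nat_eq (1 / 4 - δ) (n := 2) two_pos
    have him := congrArg Complex.im ht
    simp only [pow_two, Complex.mul_im, Complex.sub_im] at him
    norm_num at him
    have hre : t.re ≠ 0 := by
      intro h
      rw [h] at him
      linarith
    rcases lt_or_gt_of_ne hre with h | h
    · exact ⟨t, ht, h⟩
    · exact ⟨-t, by rw [neg_sq, ht], by simpa using h⟩
  refine ⟨1 / 2 + t, by linear_combination -ht.1, ?_, ?_⟩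
  · simp only [Complex.add_re]
    norm_num
    linarith
  · have him := congrArg Complex.im ht.1
    simp only [pow_two, Complex.mul_im, Complex.sub_im] at him
    norm_num at him
    simp only [Complex.add_im]
    norm_num
    nlinarith [ht.2]

/-- Antilinearity lets a phase be removed: for e² = c/|c| the vector e u is sent to ē c u = |c| e u.
-/
theorem exists_gamma_of_conj_eigenvector {N : Matrix (Fin p) (Fin p) ℂ} {c : ℂ} (hc : c ≠ 0)
    {u : Fin p → ℂ} (hu0 : u ≠ 0) (hu : conjMulVec N u = c • u) :
    ∃ v, v ≠ 0 ∧ conjMulVec N v = (‖c‖ : ℂ) • v := by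
  have hn : (‖c‖ : ℂ) ≠ 0 := by exact_mod_cast norm_ne_zero_iff.2 hc
  obtain ⟨e, he⟩ := IsAlgClosed.exists_pow_nat_eq (c / ‖c‖) (n := 2) two_pos
  have he1 : ‖e‖ = 1 := by
    have h1 : ‖e‖ ^ 2 = 1 := by
      rw [← norm_pow, he, norm_div, Complex.norm_real, norm_norm,
        div_self (norm_ne_zero_iff.2 hc)]
    exact (pow_eq_one_iff_of_nonneg (norm_nonneg _) two_ne_zero).1 h1
  have he2 : conj e * e = 1 := by
    rw [Complex.conj_mul', he1]
    simp
  have he0 : e ≠ 0 := fun h => by simp [h] at he2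
  refine ⟨e • u, smul_ne_zero he0 hu0, ?_⟩
  rw [conjMulVec_smul, hu, smul_smul, smul_smul]
  congr 1
  have h1 : c = ‖c‖ * e ^ 2 := by rw [he, mul_div_cancel₀ _ hn]
  calc conj e * c = conj e * (‖c‖ * e ^ 2) := by rw [← h1]
    _ = ‖c‖ * e * (conj e * e) := by ring
    _ = ‖c‖ * e := by rw [he2, mul_one]

/-- The eigenvalues of `N (conj N)`, when they are simple and non-zero, are closed under conjugation,
and the real ones are attained by eigenvectors of the antilinear map `v ↦ N (conj v)`. -/
theorem eigenvalue_structure {N : Matrix (Fin p) (Fin p) ℂ} {Δ : Finset ℂ} (hcard : Δ.card = p)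
    (h0 : ∀ c ∈ Δ, c ≠ 0) (hΔ : ∀ c ∈ Δ, ∃ v, v ≠ 0 ∧ (N * N.map star) *ᵥ v = c • v) :
    (∀ c ∈ Δ, conj c ∈ Δ) ∧ ∀ c ∈ Δ, c.im = 0 →
      ∃ (r : ℝ) (v : Fin p → ℂ), 0 < r ∧ c = (r ^ 2 : ℝ) ∧ v ≠ 0 ∧
        conjMulVec N v = (r : ℂ) • v := by
  classical
  have hall : ∀ (c : ℂ) (v : Fin p → ℂ), v ≠ 0 → (N * N.map star) *ᵥ v = c • v → c ∈ Δ := by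
    intro c v hv0 hv
    by_contra hc
    have := card_eigenvalues_le (N * N.map star).mulVecLin (insert c Δ) (fun d hd => by
      rcases Finset.mem_insert.1 hd with rfl | hd
      · exact ⟨v, hv0, hv⟩
      · exact hΔ d hd)
    rw [Finset.card_insert_of_notMem hc] at this
    omega
  -- The antilinear map commutes with its own square NN̄, so it conjugates eigenvalues.
  have hswap : ∀ (c : ℂ) (v : Fin p → ℂ), (N * N.map star) *ᵥ v = c • v →
      (N * N.map star) *ᵥ (conjMulVec N v) = conj c • conjMulVec N v := by
    intro c v hv
    rw [← conjMulVec_conjMulVec N (conjMulVec N v), conjMulVec_conjMulVec N v, hv, conjMulVec_smul]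
  have hne : ∀ c ∈ Δ, ∀ v, v ≠ 0 → (N * N.map star) *ᵥ v = c • v → conjMulVec N v ≠ 0 := by
    intro c hc v hv0 hv h
    rw [← conjMulVec_conjMulVec, h] at hv
    have : c • v = 0 := by
      rw [← hv, conjMulVec, star_zero, Matrix.mulVec_zero]
    exact hv0 ((smul_eq_zero.1 this).resolve_left (h0 c hc))
  choose v hv0 hv using fun c : Δ => hΔ c c.2
  have hLI : LinearIndependent ℂ v :=
    Module.End.eigenvectors_linearIndependent' (N * N.map star).mulVecLin (fun c : Δ => (c : ℂ))
      Subtype.val_injective v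
      fun c => ⟨Module.End.mem_eigenspace_iff.2 (hv c), hv0 c⟩
  let b : Module.Basis Δ ℂ (Fin p → ℂ) :=
    basisOfLinearIndependentOfCardEqFinrank' v hLI (by simp [hcard])
  have hb : ∀ c, b c = v c := fun c => by simp [b]
  -- Eigenspaces are lines, so for real c the antilinear map preserves the eigenline.
  have hsimple : ∀ (c : Δ) w, (N * N.map star) *ᵥ w = (c : ℂ) • w → ∃ a : ℂ, w = a • v c := by
    intro c w hw
    have h1 : ∀ w d, b.repr ((N * N.map star) *ᵥ w) d = d * b.repr w d := by
      intro w d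
      have h2 : (b.coord d).comp (N * N.map star).mulVecLin = (d : ℂ) • b.coord d := by
        refine b.ext fun k => ?_
        simp only [LinearMap.comp_apply, Matrix.mulVecLin_apply, LinearMap.smul_apply, hb, hv,
          map_smul]
        rw [← hb]
        by_cases hkd : k = d
        · rw [hkd]
        · simp [hkd]
      exact LinearMap.congr_fun h2 w
    refine ⟨b.repr w c, ?_⟩
    rw [← hb]
    refine b.ext_elem fun d => ?_
    by_cases hdc : d = c
    · simp [hdc]
    · have h2 := h1 w d
      rw [hw] at h2
      have h3 : ((d : ℂ) - c) * b.repr w d = 0 := by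
        simp only [map_smul, Finsupp.smul_apply, smul_eq_mul] at h2
        linear_combination -h2
      have h4 : b.repr w d = 0 := (mul_eq_zero.1 h3).resolve_left
        (sub_ne_zero.2 fun h => hdc (Subtype.ext h))
      rw [h4]
      simp [Ne.symm hdc]
  refine ⟨fun c hc => ?_, fun c hc him => ?_⟩
  · exact hall _ _ (hne c hc _ (hv0 ⟨c, hc⟩) (hv ⟨c, hc⟩)) (hswap _ _ (hv ⟨c, hc⟩))
  · have hconj : conj c = c := Complex.conj_eq_iff_im.2 him
    have h1 := hswap _ _ (hv ⟨c, hc⟩)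
    rw [hconj] at h1
    obtain ⟨a, ha⟩ := hsimple ⟨c, hc⟩ _ h1
    have ha0 : a ≠ 0 := by
      rintro rfl
      exact hne c hc _ (hv0 ⟨c, hc⟩) (hv ⟨c, hc⟩) (by rw [ha, zero_smul])
    obtain ⟨u, hu0, hu⟩ := exists_gamma_of_conj_eigenvector ha0 (hv0 ⟨c, hc⟩) ha
    refine ⟨‖a‖, u, norm_pos_iff.2 ha0, ?_, hu0, hu⟩
    -- Applying the antilinear map twice gives c = |a|², so real eigenvalues are automatically
    -- positive.
    have h2 := hv ⟨c, hc⟩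
    rw [← conjMulVec_conjMulVec, ha, conjMulVec_smul, ha, smul_smul] at h2
    have h3 := smul_left_injective ℂ (hv0 ⟨c, hc⟩) h2
    change conj a * a = c at h3
    rw [← h3, Complex.conj_mul']
    simp

theorem complexKey_injective {g g' : ℂ}
    (h : BishopInvariants.complexKey g = BishopInvariants.complexKey g') : g = g' := by
  have h1 : ((conj (g⁻¹ - 1)).arg, ‖conj (g⁻¹ - 1)‖) = ((conj (g'⁻¹ - 1)).arg, ‖conj (g'⁻¹ - 1)‖) :=
    toLex.injective h
  rw [Prod.mk.injEq] at h1
  have h2 := Complex.ext_norm_arg h1.2 h1.1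
  have h3 := (starRingEnd ℂ).injective h2
  exact inv_injective (sub_left_injective h3)

/-- Conjugation matches the upper with the lower half-plane, and the borderline real value 1/4 is
excluded. -/
theorem card_split {Δ : Finset ℂ} (hcard : Δ.card = p) (hconj : ∀ c ∈ Δ, conj c ∈ Δ)
    (h4 : ∀ c ∈ Δ, c ≠ 1 / 4) :
    (Δ.filter fun c => c.im = 0 ∧ c.re < 1 / 4).card +
      (Δ.filter fun c => c.im = 0 ∧ 1 / 4 < c.re).card +
      2 * (Δ.filter fun c => 0 < c.im).card = p := by
  classical
  have h1 : (Δ.filter fun c => c.im < 0).card = (Δ.filter fun c => 0 < c.im).card := by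
    refine Finset.card_nbij' (starRingEnd ℂ) (starRingEnd ℂ) ?_ ?_ ?_ ?_
    · intro c hc
      simp only [Finset.coe_filter, Set.mem_ofPred_eq] at hc ⊢
      exact ⟨hconj c hc.1, by simpa using hc.2⟩
    · intro c hc
      simp only [Finset.coe_filter, Set.mem_ofPred_eq] at hc ⊢
      exact ⟨hconj c hc.1, by simpa using hc.2⟩
    · intro c _
      simp
    · intro c _
      simp
  have h2 : Δ = (((Δ.filter fun c => c.im = 0 ∧ c.re < 1 / 4) ∪
      (Δ.filter fun c => c.im = 0 ∧ 1 / 4 < c.re)) ∪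
      (Δ.filter fun c => 0 < c.im)) ∪ (Δ.filter fun c => c.im < 0) := by
    ext c
    simp only [Finset.mem_union, Finset.mem_filter]
    constructor
    · intro hc
      rcases lt_trichotomy c.im 0 with h | h | h
      · exact Or.inr ⟨hc, h⟩
      · have : c.re ≠ 1 / 4 := fun hre => h4 c hc (Complex.ext (by simp [hre]) (by simp [h]))
        rcases lt_or_gt_of_ne this with h' | h'
        · exact Or.inl (Or.inl (Or.inl ⟨hc, h, h'⟩))
        · exact Or.inl (Or.inl (Or.inr ⟨hc, h, h'⟩))
      · exact Or.inl (Or.inr ⟨hc, h⟩)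
    · tauto
  rw [two_mul, ← add_assoc]
  conv_rhs => rw [← hcard, h2]
  rw [Finset.card_union_of_disjoint, Finset.card_union_of_disjoint, Finset.card_union_of_disjoint,
    h1]
  all_goals
    rw [Finset.disjoint_left]
    intro c hc hc'
    simp only [Finset.mem_union, Finset.mem_filter] at hc hc'
    have := hc'.2
    grind

/-- The ordered normal form under consimilarity of a matrix `N` for which `N (conj N)` has simple
spectrum avoiding `0` and `1/4`. -/
theorem exists_bishopInvariants {N : Matrix (Fin p) (Fin p) ℂ} {Δ : Finset ℂ}
    (hcard : Δ.card = p) (h0 : ∀ c ∈ Δ, c ≠ 0) (h4 : ∀ c ∈ Δ, c ≠ 1 / 4)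
    (hΔ : ∀ c ∈ Δ, ∃ v, v ≠ 0 ∧ (N * N.map star) *ᵥ v = c • v) :
    ∃ Γ : BishopInvariants p, Γ.Ordered ∧
      ∃ P : Matrix (Fin p) (Fin p) ℂ, IsUnit P ∧ N * P.map star = P * Γ.mat := by
  classical
  obtain ⟨hconj, hreal⟩ := eigenvalue_structure hcard h0 hΔ
  have hsum := card_split hcard hconj h4
  have hdata : ∀ c ∈ Δ, ∃ (g : ℂ) (u u' : Fin p → ℂ), (c.im = 0 → u ≠ 0 ∧ conjMulVec N u = g • u ∧
      c = g ^ 2 ∧ ∃ r : ℝ, 0 < r ∧ g = r ∧ c = (r ^ 2 : ℝ)) ∧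
      (0 < c.im → (u ≠ 0 ∧ u' ≠ 0 ∧ conjMulVec N u = (1 - conj g) • u' ∧ conjMulVec N u' = g • u) ∧
        g * (1 - g) = c ∧ g.re < 1 / 2 ∧ 0 < g.im) := by
    intro c hc
    by_cases him : c.im = 0
    · obtain ⟨r, v, hr, hcr, hv0, hv⟩ := hreal c hc him
      exact ⟨r, v, 0, fun _ => ⟨hv0, hv, by rw [hcr]; simp, r, hr, rfl, hcr⟩,
        fun h => absurd him h.ne'⟩
    · by_cases hpos : 0 < c.im
      · obtain ⟨g, hg, hg1, hg2⟩ := exists_gamma_of_im_pos hpos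
        obtain ⟨u, hu0, hu⟩ := hΔ c hc
        rw [← conjMulVec_conjMulVec] at hu
        have hg3 : 1 - conj g ≠ 0 := by
          intro h
          have := congrArg Complex.im h
          simp at this
          exact hg2.ne' this
        have hg4 : 1 - g ≠ 0 := by
          intro h
          have := congrArg Complex.im h
          simp at this
          exact hg2.ne' this
        have h1 : conjMulVec N ((1 - conj g)⁻¹ • conjMulVec N u) = g • u := by
          rw [conjMulVec_smul, hu, smul_smul, ← hg]
          congr 1
          simp
          field_simp
        -- u' spans the eigenline of c̄; the scaling produces the entries γ and 1 - γ̄ of the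
        -- complex block.
        refine ⟨g, u, (1 - conj g)⁻¹ • conjMulVec N u, fun h => absurd h him, fun _ =>
          ⟨⟨hu0, fun h => ?_, ?_, h1⟩, hg, hg1, hg2⟩⟩
        · rw [h, conjMulVec, star_zero, Matrix.mulVec_zero] at h1
          rcases smul_eq_zero.1 h1.symm with h2 | h2
          · simp [h2] at hg2
          · exact hu0 h2
        · rw [smul_smul, mul_inv_cancel₀ hg3, one_smul]
      -- Dummy values: an eigenvalue in the lower half-plane is served by the vector u' of its
      -- conjugate.
      · exact ⟨0, 0, 0, fun h => absurd h him, fun h => absurd h hpos⟩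
  choose! G u u' hr hc using hdata
  set Δe := Δ.filter fun c => c.im = 0 ∧ c.re < 1 / 4 with hΔe
  set Δh := Δ.filter fun c => c.im = 0 ∧ 1 / 4 < c.re with hΔh
  set Δc := Δ.filter fun c => 0 < c.im with hΔc
  have hGreal : ∀ c ∈ Δ, c.im = 0 → ∀ c' ∈ Δ, c'.im = 0 → (G c).re = (G c').re → c = c' := by
    intro c hcΔ him c' hcΔ' him' h
    obtain ⟨-, -, -, r, -, h1, h2⟩ := hr c hcΔ him
    obtain ⟨-, -, -, r', -, h1', h2'⟩ := hr c' hcΔ' him'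
    rw [h1, h1', Complex.ofReal_re, Complex.ofReal_re] at h
    rw [h2, h2', h]
  obtain ⟨fe, hfe, hfe'⟩ := Δe.exists_strictMono_enum (fun c => -(G c).re) (by
    intro c hc c' hc' h
    simp only [hΔe, Finset.coe_filter, Set.mem_ofPred_eq] at hc hc'
    exact hGreal c hc.1 hc.2.1 c' hc'.1 hc'.2.1 (neg_injective h))
  obtain ⟨fh, hfh, hfh'⟩ := Δh.exists_strictMono_enum (fun c => (G c).re) (by
    intro c hc c' hc' h
    simp only [hΔh, Finset.coe_filter, Set.mem_ofPred_eq] at hc hc'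
    exact hGreal c hc.1 hc.2.1 c' hc'.1 hc'.2.1 h)
  obtain ⟨fc, hfc, hfc'⟩ := Δc.exists_strictMono_enum (fun c => BishopInvariants.complexKey (G c)) (by
    intro c hcm c' hcm' h
    simp only [hΔc, Finset.coe_filter, Set.mem_ofPred_eq] at hcm hcm'
    rw [← (hc c hcm.1 hcm.2).2.1, ← (hc c' hcm'.1 hcm'.2).2.1, complexKey_injective h])
  generalize Δe.card = e at *
  generalize Δh.card = h at *
  generalize Δc.card = s at *
  simp only [hΔe, hΔh, hΔc, Finset.mem_filter] at hfe hfh hfc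
  -- An index i in the last block is the partner of i - s, whose position in the list `fc` is i - s
  -- - (e + h).
  let γ : Fin p → ℂ := fun i => if (i : ℕ) < e then G (fe i) else if (i : ℕ) < e + h then
    G (fh (i - e)) else if (i : ℕ) < e + h + s then G (fc (i - (e + h)))
    else 1 - conj (G (fc (i - s - (e + h))))
  let v : Fin p → (Fin p → ℂ) := fun i => if (i : ℕ) < e then u (fe i) else if (i : ℕ) < e + h then
    u (fh (i - e)) else if (i : ℕ) < e + h + s then u (fc (i - (e + h)))
    else u' (fc (i - s - (e + h)))
  have γe : ∀ i : Fin p, (i : ℕ) < e → γ i = G (fe i) ∧ v i = u (fe i) := fun i hi => by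
    simp [γ, v, hi]
  have γh : ∀ i : Fin p, e ≤ (i : ℕ) → (i : ℕ) < e + h →
      γ i = G (fh (i - e)) ∧ v i = u (fh (i - e)) := fun i hi hi' => by
    simp [γ, v, not_lt.2 hi, hi']
  have γc : ∀ i : Fin p, e + h ≤ (i : ℕ) → (i : ℕ) < e + h + s →
      γ i = G (fc (i - (e + h))) ∧ v i = u (fc (i - (e + h))) := fun i hi hi' => by
    have : ¬ (i : ℕ) < e := by omega
    simp [γ, v, this, not_lt.2 hi, hi']
  have γp : ∀ i : Fin p, e + h ≤ (i : ℕ) → (i : ℕ) < e + h + s →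
      γ (partner e h s hsum i) = 1 - conj (G (fc (i - (e + h)))) ∧
      v (partner e h s hsum i) = u' (fc (i - (e + h))) := fun i hi hi' => by
    have h1 : (partner e h s hsum i : ℕ) = i + s := by simp [partner, not_lt.2 hi, hi']
    have h2 : ¬ (i : ℕ) + s < e := by omega
    have h3 : ¬ (i : ℕ) + s < e + h := by omega
    have h4 : ¬ (i : ℕ) + s < e + h + s := by omega
    simp only [γ, v, h1, h2, h3, h4, if_false, Nat.add_sub_cancel, and_self]
  let Γ : BishopInvariants p :=
    { e := e, h := h, s := s, sum_eq := hsum, γ := γ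
      elliptic := fun i hi => by
        obtain ⟨hm, him, hre⟩ := hfe i hi
        obtain ⟨-, -, -, r, hr0, h1, h2⟩ := hr _ hm him
        rw [h2, Complex.ofReal_re] at hre
        exact ⟨r, hr0, by nlinarith, by rw [(γe i hi).1, h1]⟩
      hyperbolic := fun i hi hi' => by
        obtain ⟨hm, him, hre⟩ := hfh (i - e) (by omega)
        obtain ⟨-, -, -, r, hr0, h1, h2⟩ := hr _ hm him
        rw [h2, Complex.ofReal_re] at hre
        exact ⟨r, by nlinarith, by rw [(γh i hi hi').1, h1]⟩
      complex := fun i hi hi' => by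
        obtain ⟨hm, him⟩ := hfc (i - (e + h)) (by omega)
        rw [(γc i hi hi').1]
        exact (hc _ hm him).2.2
      complex_partner := fun i hi hi' => by
        rw [(γp i hi hi').1, (γc i hi hi').1] }
  have hord : Γ.Ordered := by
    rw [Γ.ordered_iff]
    refine ⟨fun i hi j hj hij => ?_, fun i hi j hj hij => ?_, fun i hi j hj hij => ?_⟩
    · change -(γ i).re < -(γ j).re
      rw [(γe i hi).1, (γe j hj).1]
      exact hfe' _ _ hij hj
    · have hij' : (i : ℕ) < j := hij
      have hj2 : (j : ℕ) < e + h := hj.2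
      have hi1 : e ≤ (i : ℕ) := hi.1
      change (γ i).re < (γ j).re
      rw [(γh i hi.1 hi.2).1, (γh j hj.1 hj.2).1]
      exact hfh' _ _ (by omega) (by omega)
    · have hij' : (i : ℕ) < j := hij
      have hj2 : (j : ℕ) < e + h + s := hj.2
      have hi1 : e + h ≤ (i : ℕ) := hi.1
      change BishopInvariants.complexKey (γ i) < BishopInvariants.complexKey (γ j)
      rw [(γc i hi.1 hi.2).1, (γc j hj.1 hj.2).1]
      exact hfc' _ _ (by omega) (by omega)
  have hv : ∀ j, v j ≠ 0 ∧ conjMulVec N (v j) = Γ.γ (Γ.prt j) • v (Γ.prt j) := by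
    intro j
    rcases Γ.block_cases j with hj | hj | hj | ⟨i, hi, rfl⟩
    · rw [Γ.prt_of_lt (by omega)]
      obtain ⟨hm, him, -⟩ := hfe j hj
      change v j ≠ 0 ∧ conjMulVec N (v j) = γ j • v j
      rw [(γe j hj).1, (γe j hj).2]
      exact ⟨(hr _ hm him).1, (hr _ hm him).2.1⟩
    · rw [Γ.prt_of_lt hj.2]
      obtain ⟨hm, him, -⟩ := hfh (j - e) (by have h1 : (j : ℕ) < e + h := hj.2
                                             have h2 : e ≤ (j : ℕ) := hj.1
                                             omega)
      change v j ≠ 0 ∧ conjMulVec N (v j) = γ j • v j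
      rw [(γh j hj.1 hj.2).1, (γh j hj.1 hj.2).2]
      exact ⟨(hr _ hm him).1, (hr _ hm him).2.1⟩
    · obtain ⟨hm, him⟩ := hfc (j - (e + h)) (by have h1 : (j : ℕ) < e + h + s := hj.2
                                                have h2 : e + h ≤ (j : ℕ) := hj.1
                                                omega)
      obtain ⟨h1, -, h2, -⟩ := (hc _ hm him).1
      change v j ≠ 0 ∧ conjMulVec N (v j) = γ (partner e h s hsum j) • v (partner e h s hsum j)
      rw [(γp j hj.1 hj.2).1, (γp j hj.1 hj.2).2, (γc j hj.1 hj.2).2]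
      exact ⟨h1, h2⟩
    · obtain ⟨hm, him⟩ := hfc (i - (e + h)) (by have h1 : (i : ℕ) < e + h + s := hi.2
                                                have h2 : e + h ≤ (i : ℕ) := hi.1
                                                omega)
      obtain ⟨-, h1, -, h2⟩ := (hc _ hm him).1
      rw [Γ.prt_prt]
      change v (partner e h s hsum i) ≠ 0 ∧ conjMulVec N (v (partner e h s hsum i)) = γ i • v i
      rw [(γp i hi.1 hi.2).2, (γc i hi.1 hi.2).1, (γc i hi.1 hi.2).2]
      exact ⟨h1, h2⟩
  -- Two applications of the antilinear map show that `v j` is an eigenvector of NN̄ for `Γ.delta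
  -- j`, and these values are distinct.
  have hLI : LinearIndependent ℂ v := by
    refine Module.End.eigenvectors_linearIndependent' (N * N.map star).mulVecLin Γ.delta
      hord.delta_injective v fun j => ⟨Module.End.mem_eigenspace_iff.2 ?_, (hv j).1⟩
    rw [Matrix.mulVecLin_apply, ← conjMulVec_conjMulVec, (hv j).2, conjMulVec_smul, (hv _).2,
      Γ.prt_prt, smul_smul, mul_comm]
    rfl
  refine ⟨Γ, hord, Matrix.of fun i j => v j i, ?_, ?_⟩
  · rw [← Matrix.linearIndependent_cols_iff_isUnit]
    exact hLI
  · ext i j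
    have h1 := congrFun (hv j).2 i
    have h2 : (N * (Matrix.of fun i j => v j i).map star) i j = conjMulVec N (v j) i := rfl
    rw [h2, Matrix.mul_apply, Finset.sum_eq_single (Γ.prt j)]
    · rw [Γ.mat_apply, if_pos (Γ.prt_prt j).symm]
      exact h1.trans (mul_comm _ _)
    · intro k _ hk
      rw [Γ.mat_apply, if_neg fun h => hk (Γ.eq_prt_comm.1 h), mul_zero]
    · simp

end

/-! ### Existence of the normal form for M -/

section

variable {p : ℕ}

theorem continuous_sqForm (A₁ A₂ : Matrix (Fin p) (Fin p) ℂ) : Continuous (sqForm A₁ A₂) := by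
  refine continuous_pi fun j => ((continuous_apply j).comp ?_).pow 2
  exact (continuous_const.matrix_mulVec continuous_id).add
    (continuous_const.matrix_mulVec continuous_star)

theorem sqForm_smul (A₁ A₂ : Matrix (Fin p) (Fin p) ℂ) (t : ℝ) (x : Fin p → ℂ) :
    sqForm A₁ A₂ ((t : ℂ) • x) = (t : ℂ) ^ 2 • sqForm A₁ A₂ x := by
  ext j
  have : star ((t : ℂ) • x) = (t : ℂ) • star x := by
    rw [star_smul, Complex.star_def, Complex.conj_ofReal]
  rw [sqForm, this, Matrix.mulVec_smul, Matrix.mulVec_smul, ← smul_add]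
  simp [sqForm, mul_pow]

/-- The existence of the normal form, on the level of quadratic functions. -/
theorem exists_normal_form {E : Fin p → MvPolynomial (Fin p ⊕ Fin p) ℂ}
    (hE : ∀ j, (E j).IsHomogeneous 2) (hB : ConditionB E) (hD : ConditionD E)
    {T : C2 p →ₗ[ℂ] C2 p} (hT : IsMoserWebster E T) (hS : ConditionE T) :
    ∃ Γ : BishopInvariants p, Γ.Ordered ∧ ∃ B : Matrix (Fin p) (Fin p) ℂ, IsUnit B ∧
      QuadEquiv (fun x => evalE E x (star x)) (sqForm B (-((2 : ℂ) • (B * Γ.mat)))) := by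
  obtain ⟨A₁, A₂, hA₂, hquad, hT1, hT2⟩ := QuadEquiv.exists_sqForm hE hB hD hT
  obtain ⟨W, hW⟩ := hA₂.exists_left_inv
  have hW' : A₂ * W = 1 := mul_eq_one_comm.1 hW
  set K := W * A₁ with hK
  have hA₁K : A₁ = A₂ * K := by rw [hK, ← Matrix.mul_assoc, hW', Matrix.one_mul]
  have hTK : ∀ x, T x = (x.1, -x.2 - (2 : ℂ) • K *ᵥ x.1) := by
    intro x
    refine Prod.ext (hT1 x) ?_
    have := congrArg (W *ᵥ ·) (hT2 x)
    simp only [Matrix.mulVec_sub, Matrix.mulVec_neg, Matrix.mulVec_smul, Matrix.mulVec_mulVec, hW,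
      Matrix.one_mulVec] at this
    exact this
  obtain ⟨S, hcard, hSv⟩ := exists_finset_eigenvalues hTK hS
  -- `(conj K) K` is injective, having `p` distinct non-zero eigenvalues
  have hKK : IsUnit (K.map star * K) := by
    choose v hv0 hv using fun c : S => (hSv c c.2).2.2
    have hLI : LinearIndependent ℂ v :=
      Module.End.eigenvectors_linearIndependent' (K.map star * K).mulVecLin (fun c : S => (c : ℂ))
        Subtype.val_injective v
        fun c => ⟨Module.End.mem_eigenspace_iff.2 (hv c), hv0 c⟩
    have htop := hLI.span_eq_top_of_card_eq_finrank' (by simp [hcard])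
    rw [← Matrix.mulVec_surjective_iff_isUnit]
    have : LinearMap.range (K.map star * K).mulVecLin = ⊤ := by
      rw [eq_top_iff, ← htop, Submodule.span_le]
      rintro _ ⟨c, rfl⟩
      refine ⟨(c : ℂ)⁻¹ • v c, ?_⟩
      rw [Matrix.mulVecLin_apply, Matrix.mulVec_smul, hv, smul_smul,
        inv_mul_cancel₀ (hSv c c.2).1, one_smul]
    exact LinearMap.range_eq_top.1 this
  have hKu : IsUnit K := by
    rw [Matrix.isUnit_iff_isUnit_det] at hKK ⊢
    rw [Matrix.det_mul] at hKK
    exact isUnit_of_mul_isUnit_right hKK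
  obtain ⟨K', hK'⟩ := hKu.exists_right_inv
  -- The factor -1/2 makes A₂P̄ = -2A₁PΓ, the second equation for B = A₁P with C = 1, equivalent to
  -- NP̄ = PΓ.
  set N : Matrix (Fin p) (Fin p) ℂ := (-(2 : ℂ)⁻¹) • K' with hN
  have hKN : K * N = (-(2 : ℂ)⁻¹) • 1 := by rw [hN, Matrix.mul_smul, hK']
  have hKNs : K.map star * N.map star = (-(2 : ℂ)⁻¹) • 1 := by
    have h1 : K.map star * N.map star = (K * N).map star :=
      (Matrix.map_mul (f := starRingEnd ℂ)).symm
    rw [h1, hKN]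
    ext i j
    by_cases hij : i = j <;> simp [hij, Complex.conj_ofNat]
  have hNN : (K.map star * K) * (N * N.map star) = (4 : ℂ)⁻¹ • 1 := by
    rw [Matrix.mul_assoc, ← Matrix.mul_assoc K, hKN, Matrix.smul_mul, Matrix.one_mul,
      Matrix.mul_smul, hKNs, smul_smul]
    norm_num
  have hNN' : (N * N.map star) * (K.map star * K) = (4 : ℂ)⁻¹ • 1 := by
    have h1 : ((4 : ℂ) • (K.map star * K)) * (N * N.map star) = 1 := by
      rw [Matrix.smul_mul, hNN, smul_smul]
      norm_num
    have h2 := mul_eq_one_comm.1 h1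
    rw [Matrix.mul_smul] at h2
    rw [← h2, smul_smul]
    norm_num
  -- NN̄ = ¼(K̄K)⁻¹ has the eigenvalues 1/(4c), and c ≠ 1 keeps them away from 1/4.
  obtain ⟨Γ, hΓ, P, hP, hNP⟩ := exists_bishopInvariants (N := N)
    (Δ := S.image fun c => (4 * c)⁻¹) (by
      rw [Finset.card_image_of_injective _ fun a b hab => by simpa using hab, hcard]) (by
      intro c hc
      obtain ⟨d, hd, rfl⟩ := Finset.mem_image.1 hc
      simpa using (hSv d hd).1) (by
      intro c hc
      obtain ⟨d, hd, rfl⟩ := Finset.mem_image.1 hc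
      intro h
      refine (hSv d hd).2.1 ?_
      rw [one_div, _root_.inv_inj] at h
      linear_combination h / 4) (by
      intro c hc
      obtain ⟨d, hd, rfl⟩ := Finset.mem_image.1 hc
      obtain ⟨hd0, -, v, hv0, hv⟩ := hSv d hd
      refine ⟨v, hv0, ?_⟩
      have h1 := congrArg ((N * N.map star) *ᵥ ·) hv
      simp only [Matrix.mulVec_mulVec, hNN', Matrix.mulVec_smul, Matrix.smul_mulVec,
        Matrix.one_mulVec] at h1
      rw [mul_inv, mul_comm, ← smul_smul, h1, smul_smul, inv_mul_cancel₀ hd0, one_smul])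
  have hA₁ : IsUnit A₁ := by rw [hA₁K]; exact hA₂.mul hKu
  refine ⟨Γ, hΓ, A₁ * P, hA₁.mul hP, hquad.symm.trans (QuadEquiv.symm ?_)⟩
  rw [quadEquiv_sqForm_iff (isUnit_neg_two_smul ((hA₁.mul hP).mul Γ.isUnit_mat)) hA₂]
  have hone : diagPerm (1 : Equiv.Perm (Fin p)) (fun _ => (1 : ℂ)) = 1 := by
    ext i j
    simp [diagPerm, Matrix.one_apply, eq_comm]
  refine ⟨P, 1, fun _ => 1, hP, fun _ => one_ne_zero, ?_, ?_⟩
  · rw [hone, Matrix.one_mul]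
  · rw [hone, Matrix.one_mul, Matrix.mul_assoc, ← hNP, hA₁K, ← Matrix.mul_assoc, Matrix.mul_assoc A₂,
      hKN]
    simp

theorem holEquiv_iff_quadEquiv {E : Fin p → MvPolynomial (Fin p ⊕ Fin p) ℂ}
    (hE : ∀ j, (E j).IsHomogeneous 2) (B : Matrix (Fin p) (Fin p) ℂ) (Γ : BishopInvariants p) :
    HolEquiv (quadricOf E) (normalQuadric B Γ) ↔
      QuadEquiv (fun x => evalE E x (star x)) (sqForm B (-((2 : ℂ) • (B * Γ.mat)))) := by
  rw [normalQuadric_eq]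
  refine ⟨fun h => QuadEquiv.of_holEquiv (fun t x => ?_) (sqForm_smul _ _)
    (continuous_sqForm _ _) h, fun h => h.holEquiv⟩
  have : star ((t : ℂ) • x) = (t : ℂ) • star x := by
    rw [star_smul, Complex.star_def, Complex.conj_ofReal]
  simp only [this, evalE_smul hE]

end

end NormalForm

theorem theorem1p1 (p : ℕ)
    (E : Fin p → MvPolynomial (Fin p ⊕ Fin p) ℂ) (hE : ∀ j, (E j).IsHomogeneous 2)
    (hB : ConditionB E) (hD : ConditionD E)
    (T₁ : C2 p →ₗ[ℂ] C2 p) (hT₁ : IsMoserWebster E T₁) (hS : ConditionE T₁) :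
    -- existence of the normal form
    (∃ Γ : BishopInvariants p, Γ.Ordered ∧ ∃ B : Matrix.GeneralLinearGroup (Fin p) ℂ,
      HolEquiv (quadricOf E) (normalQuadric B.val Γ)) ∧
    -- uniqueness of the Bishop-type invariants
    (∀ (Γ Γ' : BishopInvariants p) (B B' : Matrix.GeneralLinearGroup (Fin p) ℂ),
      Γ.Ordered → Γ'.Ordered →
      HolEquiv (quadricOf E) (normalQuadric B.val Γ) →
      HolEquiv (quadricOf E) (normalQuadric B'.val Γ') → Γ = Γ') ∧
    -- uniqueness of the matrix `B` up to exactly the equivalence relation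
    (∀ (Γ : BishopInvariants p) (B B' : Matrix.GeneralLinearGroup (Fin p) ℂ),
      HolEquiv (quadricOf E) (normalQuadric B.val Γ) →
      (HolEquiv (quadricOf E) (normalQuadric B'.val Γ) ↔
        ExtendedBishopEquiv Γ B.val B'.val)) := by
  simp only [holEquiv_iff_quadEquiv hE]
  obtain ⟨Γ₀, hΓ₀, B₀, hB₀, h₀⟩ := exists_normal_form hE hB hD hT₁ hS
  refine ⟨⟨Γ₀, hΓ₀, hB₀.unit, h₀⟩, fun Γ Γ' B B' hΓ hΓ' h h' => ?_, fun Γ B B' h => ?_⟩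
  · obtain ⟨P, -, -, hP, -, -, hPΓ⟩ :=
      (quadEquiv_normal_iff B.isUnit B'.isUnit).1 (h.symm.trans h')
    have hinj := hΓ.delta_injective
    obtain ⟨hinj', hr⟩ := delta_injective_and_range_eq hP hPΓ hinj
    exact BishopInvariants.eq_of_range_delta_eq hΓ hΓ' hinj hinj' hr
  -- Γ need not be ordered here; simplicity of its δ's is inherited from the ordered normal form Γ₀
  -- of the same M.
  · obtain ⟨P, -, -, hP, -, -, hPΓ⟩ :=
      (quadEquiv_normal_iff hB₀ B.isUnit).1 (h₀.symm.trans h)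
    have hinj := (delta_injective_and_range_eq hP hPΓ hΓ₀.delta_injective).1
    rw [← extendedBishopEquiv_iff hinj B.isUnit B'.isUnit]
    exact ⟨fun h' => h.symm.trans h', fun h' => h.trans h'⟩
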